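/- Let $F$ be a $p$-adic field (a finite extension of some $\mathbb{Q}_p$), $(\cdot,\cdot)_F$ its quadratic Hilbert symbol, and $n\ge 1$. Realize $\mathrm{GSp}_{2n}(F)=\{g\in \mathrm{GL}_{2n}(F) : gJg^{t}=\lambda(g)J\}$ with $J=\begin{pmatrix}0&I_n\\-I_n&0\end{pmatrix}$ and $i(c)=\mathrm{diag}(I_n,cI_n)$, $c\in F^*$. Let $\widetilde{\mathrm{GSp}}_{2n}(F)=\mathrm{GSp}_{2n}(F)\times\{\pm1\}$ be the metaplectic double cover defined by the extension to $\mathrm{GSp}_{2n}(F)\cong F^*\ltimes \mathrm{Sp}_{2n}(F)$ of Rao's cocycle on $\mathrm{Sp}_{2n}(F)$. Let $T'$ be the group of diagonal elements $[t,y]=\mathrm{diag}(t,yt^{-1})$ of $\mathrm{GSp}_{2n}(F)$, let $\widetilde{T}'$ be its inverse image in the cover with center $Z(\widetilde{T}')$, and let $\widetilde{T}'^{+}\subset\widetilde{T}'$ be the subgroup of elements whose similitude factor $y$ lies in $(F^*)^2$. Let $W_{2n}$ be the Weyl group of $\mathrm{Sp}_{2n}(F)$, acting by conjugation through representatives (signed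 permutation matrices in $\mathrm{Sp}_{2n}(F)$, lifted to the cover), and write ${}^g\sigma(h)=\sigma(g^{-1}hg)$. Characters are smooth homomorphisms to $\mathbb{C}^*$; a character is genuine if its value at $(I_{2n},-1)$ is $-1$. For a genuine character $\omega$ of $Z(\widetilde{T}')$ let $E(\omega)$ be the set of its extensions to genuine characters of $\widetilde{T}'^{+}$, and for $\varphi\in E(\omega)$ put $$R(\omega)=\{c\in F^*/(F^*)^2 : {}^{(i(c),1)}\varphi={}^{w}\varphi \text{ for some } w\in W_{2n}\}.$$ (1) Suppose $n$ is odd and let $\omega$ be any genuine character of $Z(\widetilde{T}')$. If $w\in W_{2n}$ satisfies ${}^w\omega=\omega$, then ${}^w\varphi=\varphi$ for every $\varphi\in E(\omega)$. Moreover $R(\omega)$ is trivial (whichever $\varphi\in E(\omega)$ is used to define it). (2) Suppose $F$ has odd residual characteristic. Let $\psi$ be an additive character of $F$ trivial on the ring of integers $\mathcal{O}$ but not on the inverse of the maximal ideal, and let $\gamma_\psi$ be the normalized Weil factor, $\gamma_\psi(a)=\gamma(\psi(ax^2))/\gamma(\psi(x^2))$ with $\gamma$ the Weil index. Let $\omega$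 be an unramified genuine character of $Z(\widetilde{T}')$, i.e. trivial on the intersection of $Z(\widetilde{T}')$ with the image of $\mathrm{GSp}_{2n}(\mathcal{O})$ under a splitting (equivalently, under every splitting) of the cover. Let $\alpha=(\alpha_1,\dots,\alpha_n)\in(\mathbb{C}^*)^n$ and $\beta\in\mathbb{C}^*$ be such that $(\chi_\alpha\boxtimes\xi_\beta)_\psi\in E(\omega)$, where $(\chi_\alpha\boxtimes\xi_\beta)_\psi$ is the genuine character of $\widetilde{T}'^{+}$ given by $$(aI_{2n},\epsilon)\,([t,1],\epsilon')\mapsto \epsilon\,\beta^{\mathrm{ord}(a)}\gamma_\psi(a^n)\cdot\epsilon'\,\chi_\alpha(t)\,\gamma_\psi(\det t),\qquad \chi_\alpha(\mathrm{diag}(a_n,\dots,a_1))=\prod_{i=1}^n\alpha_i^{\mathrm{ord}(a_i)}.$$ Let $W_{2n}$ act on parameters by $\chi_{{}^w\alpha}={}^w\chi_\alpha$. Then $|R(\omega)|>1$ if and only if $n$ is even and some $W_{2n}$-conjugate of $\alpha$ has the form $$(\alpha'_1,-\alpha'_1,\alpha'_2,-\alpha'_2,\dots,\alpha'_{n/2},-\alpha'_{n/2}),\qquad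 \alpha'_j\in\mathbb{C}^*,$$ and in that case $|R(\omega)|=2$ (again for every choice of $\varphi\in E(\omega)$ in the definition of $R(\omega)$). -/

import Mathlib

open scoped Classical Matrix Topology
open MeasureTheory Filter

noncomputable section

namespace Metaplectic

/-! ### The quadratic Hilbert symbol -/

/-- The quadratic Hilbert symbol: `1` if `z² = a x² + b y²` has a nontrivial solution, else `-1`. -/
def hilbert {F : Type*} [Field F] (a b : Fˣ) : ℤˣ :=
  if ∃ x y z : F, (x ≠ 0 ∨ y ≠ 0 ∨ z ≠ 0) ∧ z ^ 2 = a * x ^ 2 + b * y ^ 2 then 1 else -1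

/-- The subgroup of nonzero squares of `F`. -/
def squares (F : Type*) [Field F] : Subgroup Fˣ := (powMonoidHom 2 : Fˣ →* Fˣ).range

/-! ### Linear groups

`2n × 2n` matrices are indexed by `Fin n ⊕ Fin n`; they act on row vectors from the right.
The first `n` basis vectors `e_i` span `V`, the last `n` basis vectors `e_i^*` span `V^*`. -/

section Linear

variable (n : ℕ) (F : Type*) [Field F]

/-- The standard skew-symmetric matrix `(0 I; -I 0)`. -/
def J : Matrix (Fin n ⊕ Fin n) (Fin n ⊕ Fin n) F := Matrix.fromBlocks 0 1 (-1) 0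

/-- The general symplectic group `{g ∈ GL_{2n}(F) | g J gᵗ = λ J for some λ ∈ F^*}`. -/
def GSp : Subgroup (GL (Fin n ⊕ Fin n) F) where
  carrier := {g | ∃ l : Fˣ, g.val * J n F * g.valᵀ = (l : F) • J n F}
  one_mem' := ⟨1, by simp⟩
  mul_mem' := by
    rintro g h ⟨l, hl⟩ ⟨m, hm⟩
    refine ⟨l * m, ?_⟩
    have : (g * h).val * J n F * (g * h).valᵀ = g.val * (h.val * J n F * h.valᵀ) * g.valᵀ := by
      simp only [Units.val_mul, Matrix.transpose_mul, Matrix.mul_assoc]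
    rw [this, hm, Matrix.mul_smul, Matrix.smul_mul, hl, smul_smul]
    simp [mul_comm]
  inv_mem' := by
    rintro g ⟨l, hl⟩
    refine ⟨l⁻¹, ?_⟩
    have h1 : (g⁻¹).val * g.val = 1 := by rw [← Units.val_mul]; simp
    have h2 : g.valᵀ * (g⁻¹).valᵀ = 1 := by rw [← Matrix.transpose_mul, h1, Matrix.transpose_one]
    have h3 : (g⁻¹).val * (g.val * J n F * g.valᵀ) * (g⁻¹).valᵀ = J n F := by
      calc (g⁻¹).val * (g.val * J n F * g.valᵀ) * (g⁻¹).valᵀ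
          = ((g⁻¹).val * g.val) * J n F * (g.valᵀ * (g⁻¹).valᵀ) := by
            simp only [Matrix.mul_assoc]
        _ = J n F := by rw [h1, h2, Matrix.one_mul, Matrix.mul_one]
    rw [hl, Matrix.mul_smul, Matrix.smul_mul] at h3
    have h4 := congrArg (fun M => ((l⁻¹ : Fˣ) : F) • M) h3
    simp only [smul_smul, ← Units.val_mul, inv_mul_cancel, Units.val_one, one_smul] at h4
    exact h4

variable {n F}

/-- The similitude factor `λ(g)`, with `g J gᵗ = λ(g) J` (unique when `n ≥ 1`). -/
def sim (g : GSp n F) : Fˣ := Classical.choose g.2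

/-- `g ∈ Sp_{2n}(F)`, i.e. `g J gᵗ = J`. -/
def IsSymplectic (g : GL (Fin n ⊕ Fin n) F) : Prop := g.val * J n F * g.valᵀ = J n F

/-- The element `[t, y] = diag(t, y t⁻¹)` of the maximal torus of `GSp`; its similitude
factor is `y`. -/
def torus (t : Fin n → Fˣ) (y : Fˣ) : GSp n F :=
  ⟨⟨Matrix.diagonal (Sum.elim (fun i => (t i : F)) fun i => (y * (t i)⁻¹ : F)),
    Matrix.diagonal (Sum.elim (fun i => ((t i)⁻¹ : F)) fun i => (y⁻¹ * t i : F)),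
    by
      rw [Matrix.diagonal_mul_diagonal, ← Matrix.diagonal_one]
      congr 1
      ext i
      rcases i with i | i <;> simp <;> field_simp,
    by
      rw [Matrix.diagonal_mul_diagonal, ← Matrix.diagonal_one]
      congr 1
      ext i
      rcases i with i | i <;> simp <;> field_simp⟩,
   y, by
      ext i j
      by_cases hij : Sum.elim id id i = Sum.elim id id j <;>
        rcases i with i | i <;> rcases j with j | j <;>
          simp_all [J, Matrix.diagonal_transpose, Matrix.diagonal_mul, Matrix.mul_diagonal,
            Matrix.one_apply] <;> field_simp⟩

/-- The embedding `i(c) = diag(I, c I)` of `F^*` in `GSp`. -/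
def iSim (c : Fˣ) : GSp n F := torus 1 c

/-- The Sp-component `g₁ = i(λ(g))⁻¹ g` of `g`. -/
def spPart (g : GSp n F) : GSp n F := (iSim (sim g))⁻¹ * g

/-- The torus `T'` of diagonal matrices in `GSp`. -/
def IsTorus (g : GSp n F) : Prop := ∃ t y, g = torus t y

/-- Representatives in `Sp_{2n}` for the Weyl group `W_{2n}`: signed permutation matrices which
are symplectic. -/
def IsWeyl (w : GSp n F) : Prop :=
  IsSymplectic w.val ∧ ∃ (σ : Equiv.Perm (Fin n ⊕ Fin n)) (s : Fin n ⊕ Fin n → ℤˣ),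
    ∀ i j, w.val.val i j = if j = σ i then ((s i : ℤ) : F) else 0

/-! ### Rao's cocycle -/

/-- The symplectic form `⟨u, v⟩ = u J vᵗ` on row vectors. -/
def form (u v : Fin n ⊕ Fin n → F) : F := (u ᵥ* J n F) ⬝ᵥ v

/-- The Lagrangian `V^* = span(e_1^*, …, e_n^*)`. -/
def Vstar (n : ℕ) (F : Type*) [Field F] : Submodule F (Fin n ⊕ Fin n → F) where
  carrier := {v | ∀ i, v (Sum.inl i) = 0}
  zero_mem' := by simp
  add_mem' := by
    intro a b ha hb i
    simp [ha i, hb i]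
  smul_mem' := by
    intro c a ha i
    simp [ha i]

/-- The image `V^* g` of `V^*` under the right action of `g`. -/
def VstarMul (g : GL (Fin n ⊕ Fin n) F) : Submodule F (Fin n ⊕ Fin n → F) :=
  (Vstar n F).map (Matrix.vecMulLinear g.val)

/-- The index `j` of the Bruhat cell `Ω_j = {g | dim (V^* ∩ V^* g) = n - j}` containing `g`:
the rank of the lower left block. -/
def cell (g : GL (Fin n ⊕ Fin n) F) : ℕ := g.val.toBlocks₂₁.rank

/-- The Siegel parabolic subgroup of `Sp_{2n}`, the stabilizer of `V^*`. -/
def IsSiegel (p : GL (Fin n ⊕ Fin n) F) : Prop := IsSymplectic p ∧ p.val.toBlocks₂₁ = 0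

/-- The matrix `τ_S`: `e_i τ_S = -e_i^*`, `e_i^* τ_S = e_i` for `i ∈ S`, the other basis vectors
being fixed. -/
def tau (S : Finset (Fin n)) : Matrix (Fin n ⊕ Fin n) (Fin n ⊕ Fin n) F :=
  Matrix.fromBlocks (Matrix.diagonal fun i => if i ∈ S then 0 else 1)
    (Matrix.diagonal fun i => if i ∈ S then -1 else 0)
    (Matrix.diagonal fun i => if i ∈ S then 1 else 0)
    (Matrix.diagonal fun i => if i ∈ S then 0 else 1)

/-- `u = det(p₁ p₂ | V)` for some decomposition `g = p₁ τ_S p₂` with `p₁, p₂` in the Siegel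
parabolic. -/
def IsRaoX (g : GL (Fin n ⊕ Fin n) F) (u : Fˣ) : Prop :=
  ∃ p₁ p₂ : GL (Fin n ⊕ Fin n) F, ∃ S : Finset (Fin n), IsSiegel p₁ ∧ IsSiegel p₂ ∧
    g.val = p₁.val * tau S * p₂.val ∧
    (u : F) = p₁.val.toBlocks₁₁.det * p₂.val.toBlocks₁₁.det

/-- Rao's function `x : Sp_{2n}(F) → F^* / (F^*)²`, `x(p₁ τ_S p₂) = det(p₁ p₂ | V)`; a chosen
representative of the class, which is well defined. -/
def raoX (g : GL (Fin n ⊕ Fin n) F) : Fˣ :=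
  if h : ∃ u, IsRaoX g u then Classical.choose h else 1

/-- A diagonalization of the Leray invariant attached to `(V^*, V^* g₁, V^* g₂⁻¹)`. This is the
nondegenerate quotient of the quadratic form `x ↦ ⟨a, b⟩` on `V^* ∩ (V^* g₁ + V^* g₂⁻¹)`, where
`x = a + b` with `a ∈ V^* g₁`, `b ∈ V^* g₂⁻¹`; its radical is
`(V^* ∩ V^* g₁) + (V^* ∩ V^* g₂⁻¹)`. The data are vectors `a_i + b_i`, orthogonal for the form,
with nonzero values `d_i`, which generate the space together with the radical. -/
structure LerayDiag (g₁ g₂ : GL (Fin n ⊕ Fin n) F) where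
  k : ℕ
  a : Fin k → Fin n ⊕ Fin n → F
  b : Fin k → Fin n ⊕ Fin n → F
  d : Fin k → Fˣ
  a_mem : ∀ i, a i ∈ VstarMul g₁
  b_mem : ∀ i, b i ∈ VstarMul g₂⁻¹
  add_mem : ∀ i, a i + b i ∈ Vstar n F
  orthogonal : ∀ i j, form (a i) (b j) = if i = j then (d i : F) else 0
  span : Vstar n F ⊓ (VstarMul g₁ ⊔ VstarMul g₂⁻¹) ≤
    Submodule.span F (Set.range fun i => a i + b i) ⊔
      (Vstar n F ⊓ VstarMul g₁) ⊔ (Vstar n F ⊓ VstarMul g₂⁻¹)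

/-- The Leray invariant of `(V^*, V^* g₁, V^* g₂⁻¹)` as a diagonal form `⟨d_1, …, d_k⟩`
(a diagonalization always exists). -/
def leray (g₁ g₂ : GL (Fin n ⊕ Fin n) F) : Σ k : ℕ, Fin k → Fˣ :=
  if h : Nonempty (LerayDiag g₁ g₂) then ⟨(Classical.choice h).k, (Classical.choice h).d⟩
  else ⟨0, Fin.elim0⟩

/-- Rao's `{±1}`-valued cocycle on `Sp_{2n}(F)`:
`(x₁, x₂) (-x₁ x₂, x₁₂) ((-1)^l, disc ρ) (-1, -1)^{l(l-1)/2} h(ρ)`, where `x₁ = x(g₁)`,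
`x₂ = x(g₂)`, `x₁₂ = x(g₁ g₂)`, `ρ` is the Leray invariant of `(V^*, V^* g₁, V^* g₂⁻¹)` with
discriminant `disc ρ` and Hasse invariant `h(ρ)`, and
`2 l = j(g₁) + j(g₂) - j(g₁ g₂) - dim ρ`. -/
def rao (g₁ g₂ : GL (Fin n ⊕ Fin n) F) : ℤˣ :=
  let ρ := leray g₁ g₂
  let l : ℕ := (cell g₁ + cell g₂ - (cell (g₁ * g₂) + ρ.1)) / 2
  hilbert (raoX g₁) (raoX g₂) * hilbert (-(raoX g₁ * raoX g₂)) (raoX (g₁ * g₂)) *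
    hilbert ((-1) ^ l) (∏ i, ρ.2 i) * hilbert (-1 : Fˣ) (-1) ^ (l * (l - 1) / 2) *
    ∏ i, ∏ j ∈ Finset.univ.filter fun j => i < j, hilbert (ρ.2 i) (ρ.2 j)

/-- The sign `v_c(g)` such that `(g, ε) ↦ (i(c)⁻¹ g i(c), ε v_c(g))` is the lift of the
conjugation by `i(c)` to the metaplectic cover of `Sp_{2n}(F)`:
`v_c(g) = (x(g), c^{j+1}) (c, c)^{j(j-1)/2}` on the cell `Ω_j`. -/
def liftSign (c : Fˣ) (g : GL (Fin n ⊕ Fin n) F) : ℤˣ :=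
  hilbert (raoX g) (c ^ (cell g + 1)) * hilbert c c ^ (cell g * (cell g - 1) / 2)

/-- The extension of Rao's cocycle to `GSp_{2n}(F) = F^* ⋉ Sp_{2n}(F)`. -/
def cocycle (g h : GSp n F) : ℤˣ :=
  liftSign (sim h) (spPart g).val *
    rao ((iSim (sim h))⁻¹ * spPart g * iSim (sim h) : GSp n F).val (spPart h).val

end Linear

/-! ### The metaplectic double cover of `GSp` -/

/-- The metaplectic double cover, realized on the set `GSp_{2n}(F) × {±1}`. -/
@[ext] structure Mp (n : ℕ) (F : Type*) [Field F] where
  g : GSp n F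
  ε : ℤˣ

section Cover

variable {n : ℕ} {F : Type*} [Field F]

instance : Mul (Mp n F) := ⟨fun x y => ⟨x.g * y.g, x.ε * y.ε * cocycle x.g y.g⟩⟩

/-- The conjugate `h^g = g⁻¹ h g` in the metaplectic cover: the element over `g⁻¹ h g`
with `g * h^g = h * g`. -/
def conj (g h : Mp n F) : Mp n F :=
  ⟨g.g⁻¹ * h.g * g.g, h.ε * cocycle h.g g.g * cocycle g.g (g.g⁻¹ * h.g * g.g)⟩

theorem mul_conj (g h : Mp n F) : g * conj g h = h * g := by
  have key : ∀ a b c d : ℤˣ, a * (b * c * d) * d = b * a * c := by decide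
  show (⟨g.g * (g.g⁻¹ * h.g * g.g), _⟩ : Mp n F) = ⟨h.g * g.g, _⟩
  refine Mp.ext ?_ ?_
  · show g.g * (g.g⁻¹ * h.g * g.g) = h.g * g.g
    group
  · exact key _ _ _ _

variable (n F) in
/-- The inverse image `T̃'` of the maximal torus of `GSp`. -/
def TCover : Set (Mp n F) := {x | IsTorus x.g}

variable (n F) in
/-- The center `Z(T̃')` of `T̃'`. -/
def ZT : Set (Mp n F) := {z | z ∈ TCover n F ∧ ∀ x ∈ TCover n F, z * x = x * z}

variable (n F) in
/-- `T̃'⁺`: the inverse image of the elements of the torus of `GSp` whose similitude factor is a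
square. -/
def TPlus : Set (Mp n F) := {x | ∃ t s, x.g = torus t (s ^ 2)}

/-- The conjugate `^g σ : h ↦ σ(g⁻¹ h g)` of a function on `H`, for `g` normalizing `H`. -/
def twist {H : Set (Mp n F)} (g : Mp n F) (σ : H → ℂˣ) : H → ℂˣ :=
  fun h => if hm : conj g (h : Mp n F) ∈ H then σ ⟨conj g h, hm⟩ else 1

/-- For `φ` a character of `T̃'⁺`, the set of classes `c` in `F^* / (F^*)²` such that
`^{(i(c),1)} φ = ^w φ` for some `w` in the Weyl group. For `φ ∈ E(ω)` this is `R(ω)`. -/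
def R (φ : TPlus n F → ℂˣ) : Set (Fˣ ⧸ squares F) :=
  {x | ∃ c : Fˣ, QuotientGroup.mk c = x ∧
    ∃ w : GSp n F, IsWeyl w ∧ twist ⟨iSim c, 1⟩ φ = twist ⟨w, 1⟩ φ}

end Cover

/-! ### Genuine characters over a `p`-adic field -/

section Local

variable {n : ℕ} {F : Type*} [NontriviallyNormedField F]

/-- A (smooth) genuine character of a subgroup `H` of `T̃'`: a multiplicative function to `ℂ^*`,
equal to `-1` at `(I, -1)`, and trivial near the identity (the cover splits canonically over a
small open subgroup of the torus, by `g ↦ (g, 1)`). -/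
structure GenuineChar (H : Set (Mp n F)) where
  toFun : H → ℂˣ
  map_mul : ∀ x y z : H, (x : Mp n F) * y = z → toFun z = toFun x * toFun y
  genuine : ∀ x : H, (x : Mp n F) = ⟨1, -1⟩ → toFun x = -1
  smooth : ∃ U ∈ 𝓝 (1 : GL (Fin n ⊕ Fin n) F), ∀ x : H,
    (x : Mp n F).g.val ∈ U → (x : Mp n F).ε = 1 → toFun x = 1

/-- `E(ω)`: the set of extensions of `ω` to genuine characters of `T̃'⁺`. -/
def E (ω : GenuineChar (ZT n F)) : Set (GenuineChar (TPlus n F)) :=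
  {φ | ∀ (z : ZT n F) (h : TPlus n F), (z : Mp n F) = h → φ.toFun h = ω.toFun z}

/-- The maximal compact subgroup `GSp_{2n}(O)`. -/
def IsMaxCompact (k : GSp n F) : Prop :=
  (∀ i j, ‖k.val.val i j‖ ≤ 1) ∧ ‖k.val.val.det‖ = 1

/-- `k ↦ (k, ι k)` is a splitting of the cover over `GSp_{2n}(O)`. -/
def IsSplitting (ι : GSp n F → ℤˣ) : Prop :=
  ∀ k k' : GSp n F, IsMaxCompact k → IsMaxCompact k' → ι (k * k') = ι k * ι k' * cocycle k k'

/-- `ω` is unramified: trivial on the intersection of `Z(T̃')` with the image of `GSp_{2n}(O)`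
under a splitting (the condition does not depend on the splitting). -/
def IsUnramified (ω : GenuineChar (ZT n F)) : Prop :=
  ∀ ι : GSp n F → ℤˣ, IsSplitting ι → ∀ k, IsMaxCompact k →
    ∀ z : ZT n F, (z : Mp n F) = ⟨k, ι k⟩ → ω.toFun z = 1

/-- `ϖ` generates the maximal ideal of the ring of integers. -/
def IsUniformizer (ϖ : Fˣ) : Prop := ‖(ϖ : F)‖ < 1 ∧ ∀ x : F, ‖x‖ < 1 → ‖x‖ ≤ ‖(ϖ : F)‖

/-- The order of `a`: the integer `k` with `‖a‖ = ‖ϖ‖ ^ k`. -/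
def ord (ϖ a : Fˣ) : ℤ := ⌊Real.logb ‖(ϖ : F)‖ ‖(a : F)‖⌋

/-- `ψ` is a normalized character of `F`: continuous, trivial on the ring of integers `O`, and
not trivial on `ϖ⁻¹ O`. -/
def IsNormalized (ϖ : Fˣ) (ψ : AddChar F Circle) : Prop :=
  Continuous ψ ∧ (∀ x : F, ‖x‖ ≤ 1 → ψ x = 1) ∧ ∃ x : F, ‖x‖ ≤ ‖(ϖ : F)‖⁻¹ ∧ ψ x ≠ 1

/-- The integral of `ψ(a x²)` over the ball of radius `m`, for a Haar measure. -/
def gaussIntegral [ProperSpace F] (ψ : AddChar F Circle) (a : Fˣ) (m : ℕ) : ℂ :=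
  letI : MeasurableSpace F := borel F
  haveI : BorelSpace F := ⟨rfl⟩
  ∫ x in Metric.closedBall (0 : F) m, (ψ (a * x ^ 2) : ℂ) ∂(Measure.addHaar : Measure F)

/-- The Weil index of the character of second degree `x ↦ ψ(a x²)`: the phase of the integral of
`ψ(a x²)` over large balls (which is eventually constant). -/
def weilIndex [ProperSpace F] (ψ : AddChar F Circle) (a : Fˣ) : ℂ :=
  limUnder atTop fun m : ℕ => gaussIntegral ψ a m / (‖gaussIntegral ψ a m‖ : ℂ)

/-- The normalized Weil factor `γ_ψ(a)`. -/
def weilFactor [ProperSpace F] (ψ : AddChar F Circle) (a : Fˣ) : ℂ :=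
  weilIndex ψ a / weilIndex ψ 1

/-- `χ_α(diag(a_n, …, a_1, a_n⁻¹, …, a_1⁻¹)) = ∏ α_i ^ ord(a_i)`, for
`t = diag(a_n, …, a_1)`. -/
def chiAlpha (ϖ : Fˣ) (α : Fin n → ℂˣ) (t : Fin n → Fˣ) : ℂˣ :=
  ∏ i, α i ^ ord ϖ (t (Fin.rev i))

/-- `φ` is the genuine character `(χ_α ⊠ ξ_β)_ψ` of `T̃'⁺ = Z(GSp̃⁺) T̃`, where
`ξ_β(a) = β ^ ord(a)`: for `z = (a I, ε)` and `h = ([t, 1], ε')` one has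
`φ(z h) = (ε ξ_β(a) γ_ψ(aⁿ)) (ε' χ_α(t) γ_ψ(det t))`. -/
def IsStandard [ProperSpace F] (ϖ : Fˣ) (ψ : AddChar F Circle) (α : Fin n → ℂˣ) (β : ℂˣ)
    (φ : GenuineChar (TPlus n F)) : Prop :=
  ∀ (a : Fˣ) (t : Fin n → Fˣ) (ε ε' : ℤˣ) (x : TPlus n F),
    (x : Mp n F) = ⟨torus (fun _ => a) (a ^ 2), ε⟩ * ⟨torus t 1, ε'⟩ →
    (φ.toFun x : ℂ) =
      (((ε : ℤ) : ℂ) * ((β ^ ord ϖ a : ℂˣ) : ℂ) * weilFactor ψ (a ^ n)) *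
        (((ε' : ℤ) : ℂ) * (chiAlpha ϖ α t : ℂ) * weilFactor ψ (∏ i, t i))

/-- `α' = ^w α` for some `w` in the Weyl group, i.e. `χ_{α'} = ^w χ_α` on the torus of `Sp`. -/
def WeylConj (ϖ : Fˣ) (α α' : Fin n → ℂˣ) : Prop :=
  ∃ w : GSp n F, IsWeyl w ∧ ∀ t t' : Fin n → Fˣ,
    torus t' 1 = w⁻¹ * torus t 1 * w → chiAlpha ϖ α' t = chiAlpha ϖ α t'

end Local

/-- `(a_0, -a_0, a_1, -a_1, …)`. -/
def pairedAlpha (n : ℕ) (a : ℕ → ℂˣ) : Fin n → ℂˣ :=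
  fun i => if Even (i : ℕ) then a (i / 2) else -a (i / 2)

end Metaplectic

end

noncomputable section

namespace Metaplectic

universe u

/-! ### Elementary properties of the Hilbert symbol -/

section Hilbert

variable {F : Type*} [Field F]

/-! Everything reduces to the torus. There Rao's cocycle, extended to `GSp`, is `(det t, y')(det t,
det t')` (`cocycle_torus`). Conjugation by `i(c)` therefore fixes `[t, y]` and multiplies the sign
by `(det t, c)` (`conj_iSim`). A Weyl element maps `([t, s²], ε)` to `([t^w, s²], ε)` without a sign
(`conj_weyl`), and `det t^w` equals `det t` modulo squares, since inverting an entry `x` to `s² x⁻¹`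
preserves its class. Elements with square similitude and square determinant are central. In
particular `[t^w t⁻¹, 1]` is central, so the ratio of `^w φ` and `φ` depends only on `ω`, and hence
so does `R`.

For odd `n` the scalar `a I` has determinant `a` modulo squares. Dividing `t` by the scalar `det t`
leaves a central element, so the plus part of the torus cover is the product of the center and the
scalars. The Weyl group fixes scalars, so invariance of `ω` passes to `φ`. Evaluating `^{i(c)} φ =
^w φ` at scalars gives `(a, c) = 1` for all `a`, and nondegeneracy of the Hilbert symbol
(`exists_hilbert_ne_one`, in every residual characteristic) makes `c` a square.

For even `n` scalars have square determinant and drop out, and the Weil factor depends only on the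
square class of `det t` (`weilFactor_mul_sq`). The condition on `c` becomes `^w χ_α = (det ·, c)
χ_α`. In odd residual characteristic, for a nonsquare `c`, testing on units forces `c` to have even
order. Then `(a, c) = (-1)^{ord a}`, so the right side is `χ_{-α}`, and there is exactly one such
class `c`. It remains to see when `-α` is Weyl conjugate to `α`. Through the traces `x + x⁻¹` this
says that the multiset of traces is stable under negation, which for even `n` means that it splits
into opposite pairs. -/

theorem hilbert_eq_one_iff {a b : Fˣ} : hilbert a b = 1 ↔
    ∃ x y z : F, (x ≠ 0 ∨ y ≠ 0 ∨ z ≠ 0) ∧ z ^ 2 = a * x ^ 2 + b * y ^ 2 := by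
  unfold hilbert
  split_ifs with h
  · simp [h]
  · exact iff_of_false (by decide) h

theorem hilbert_congr {a b c d : Fˣ} (h : hilbert a b = 1 ↔ hilbert c d = 1) :
    hilbert a b = hilbert c d := by
  rcases Int.units_eq_one_or (hilbert a b) with h1 | h1 <;>
    rcases Int.units_eq_one_or (hilbert c d) with h2 | h2 <;> simp_all

theorem hilbert_comm (a b : Fˣ) : hilbert a b = hilbert b a := by
  apply hilbert_congr
  rw [hilbert_eq_one_iff, hilbert_eq_one_iff]
  constructor <;> rintro ⟨x, y, z, h, e⟩ <;> exact ⟨y, x, z, by tauto, by rw [e]; ring⟩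

theorem hilbert_mul_sq_right (a b s : Fˣ) : hilbert a (b * s ^ 2) = hilbert a b := by
  apply hilbert_congr
  rw [hilbert_eq_one_iff, hilbert_eq_one_iff]
  have hs : (s : F) ≠ 0 := s.ne_zero
  constructor <;> rintro ⟨x, y, z, h, e⟩
  · refine ⟨x, s * y, z, ?_, ?_⟩
    · simpa [hs] using h
    · rw [e]; push_cast; ring
  · refine ⟨x, y / s, z, ?_, ?_⟩
    · simpa [hs] using h
    · rw [e]; push_cast; field_simp

theorem hilbert_mul_sq_left (a b s : Fˣ) : hilbert (a * s ^ 2) b = hilbert a b := by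
  rw [hilbert_comm, hilbert_mul_sq_right, hilbert_comm]

theorem hilbert_one_left (a : Fˣ) : hilbert 1 a = 1 :=
  hilbert_eq_one_iff.2 ⟨1, 0, 1, by simp, by simp⟩

theorem hilbert_one_right (a : Fˣ) : hilbert a 1 = 1 := by
  rw [hilbert_comm, hilbert_one_left]

theorem hilbert_sq_right (a s : Fˣ) : hilbert a (s ^ 2) = 1 := by
  rw [← one_mul (s ^ 2), hilbert_mul_sq_right, hilbert_one_right]

theorem hilbert_sq_left (a s : Fˣ) : hilbert (s ^ 2) a = 1 := by
  rw [hilbert_comm, hilbert_sq_right]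

theorem hilbert_neg_self (a : Fˣ) : hilbert (-a) a = 1 :=
  hilbert_eq_one_iff.2 ⟨1, 1, 0, by simp, by push_cast; ring⟩

theorem hilbert_of_add_eq_one {a b : Fˣ} (h : (a : F) + b = 1) : hilbert a b = 1 :=
  hilbert_eq_one_iff.2 ⟨1, 1, 1, by simp, by simp [h]⟩

theorem hilbert_eq_one_iff_norm {c a : Fˣ} (hc : ¬ IsSquare (c : F)) :
    hilbert c a = 1 ↔ ∃ x y : F, (a : F) = x ^ 2 - c * y ^ 2 := by
  rw [hilbert_eq_one_iff]
  constructor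
  · rintro ⟨x, y, z, h, e⟩
    by_cases hy : y = 0
    · subst hy
      exfalso
      by_cases hx : x = 0
      · simp_all
      · exact hc ⟨z / x, by field_simp; rw [e]; ring⟩
    · refine ⟨z / y, x / y, ?_⟩
      field_simp
      rw [e]; ring
  · rintro ⟨x, y, e⟩
    exact ⟨y, 1, x, by simp, by rw [e]; ring⟩

/-- Norms from `F(√c)` are closed under multiplication (Brahmagupta's identity). -/
theorem hilbert_mul_eq_one {c a b : Fˣ} (hc : ¬ IsSquare (c : F)) (ha : hilbert c a = 1)
    (hb : hilbert c b = 1) : hilbert c (a * b) = 1 := by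
  rw [hilbert_eq_one_iff_norm hc] at *
  obtain ⟨x, y, h⟩ := ha
  obtain ⟨x', y', h'⟩ := hb
  exact ⟨x * x' + c * y * y', x * y' + x' * y, by push_cast; rw [h, h']; ring⟩

/-- If `z² = a x² + b y²`, then `(a x + b y)² = (a + b) z² - a b (x - y)²`. -/
theorem hilbert_add_neg_mul {a b s : Fˣ} (hs : (s : F) = a + b) (h : hilbert a b = 1) :
    hilbert s (-(a * b)) = 1 := by
  rw [hilbert_eq_one_iff] at *
  obtain ⟨x, y, z, h, e⟩ := h
  refine ⟨z, x - y, a * x + b * y, ?_, ?_⟩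
  · by_contra hh
    push Not at hh
    obtain ⟨hz, hxy, hu⟩ := hh
    obtain rfl : x = y := sub_eq_zero.1 hxy
    rw [← add_mul, ← hs] at hu
    have : x = 0 := by simpa using hu
    simp_all
  · rw [e, hs]; push_cast; ring

theorem mem_squares_iff {a : Fˣ} : a ∈ squares F ↔ ∃ s, a = s ^ 2 := by
  simp [squares, MonoidHom.mem_range, eq_comm]

theorem isSquare_coe_iff {a : Fˣ} : IsSquare (a : F) ↔ ∃ s, a = s ^ 2 := by
  constructor
  · rintro ⟨r, hr⟩
    have : r ≠ 0 := by
      rintro rfl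
      simp at hr
    exact ⟨Units.mk0 r this, Units.ext (by simp [hr, sq])⟩
  · rintro ⟨s, rfl⟩
    exact ⟨s, by push_cast; ring⟩

end Hilbert

/-! ### Arithmetic of local fields -/

/-- The closed unit ball is compact and the maximal ideal is open in it, so the quotient is finite.
-/
theorem exists_finite_residue_ring (F : Type u) [NontriviallyNormedField F] [IsUltrametricDist F]
    [ProperSpace F] :
    ∃ (k : Type u) (_ : Field k) (_ : Finite k) (O : Subring F) (r : O →+* k),
      Function.Surjective r ∧ (∀ x, x ∈ O ↔ ‖x‖ ≤ 1) ∧ ∀ x : O, r x = 0 ↔ ‖(x : F)‖ < 1 := by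
  let V := (NormedField.valuation (K := F)).valuationSubring
  have hV : ∀ x : F, x ∈ V ↔ ‖x‖ ≤ 1 := fun x => by
    simp [V, Valuation.mem_valuationSubring_iff, ← NNReal.coe_le_coe]
  have hm : ∀ x : V, x ∈ IsLocalRing.maximalIdeal V ↔ ‖(x : F)‖ < 1 := fun x => by
    have : x ∈ IsLocalRing.maximalIdeal V ↔ V.valuation x < 1 := (V.valuation_lt_one_iff x)
    rw [this, ← not_le, ← not_le, not_iff_not]
    by_cases hx : (x : F) = 0
    · simp [hx]
    have h2 : (x : F)⁻¹ ∈ V ↔ 1 ≤ V.valuation (x : F) := by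
      rw [← V.valuation_le_one_iff, map_inv₀, inv_le_one₀ (by simpa [zero_lt_iff] using hx)]
    rw [← h2, hV, norm_inv, inv_le_one₀ (norm_pos_iff.2 hx)]
  have hball : (V : Set F) = Metric.closedBall 0 1 := by ext x; simp [hV]
  have : CompactSpace V := isCompact_iff_compactSpace.1 (hball ▸ isCompact_closedBall 0 1)
  have hopen : IsOpen ((IsLocalRing.maximalIdeal V).toAddSubgroup : Set V) := by
    have : ((IsLocalRing.maximalIdeal V).toAddSubgroup : Set V) =
        Subtype.val ⁻¹' Metric.ball (0 : F) 1 := by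
      ext x
      simpa using hm x
    rw [this]
    exact Metric.isOpen_ball.preimage continuous_subtype_val
  have hfin : Finite (V ⧸ (IsLocalRing.maximalIdeal V).toAddSubgroup) :=
    AddSubgroup.quotient_finite_of_isOpen _ hopen
  exact ⟨IsLocalRing.ResidueField V, inferInstance, hfin, V.toSubring,
    (IsLocalRing.residue V : V →+* IsLocalRing.ResidueField V),
    IsLocalRing.residue_surjective (R := V), hV,
    fun x => (IsLocalRing.residue_eq_zero_iff (R := V) x).trans (hm x)⟩

section LocalField

variable {F : Type*} [NontriviallyNormedField F] [IsUltrametricDist F]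

theorem norm_add_eq_left {x y : F} (h : ‖y‖ < ‖x‖) : ‖x + y‖ = ‖x‖ := by
  rw [IsUltrametricDist.norm_add_eq_max_of_norm_ne_norm h.ne', max_eq_left h.le]

theorem norm_add_le_of_le {x y : F} {r : ℝ} (hx : ‖x‖ ≤ r) (hy : ‖y‖ ≤ r) : ‖x + y‖ ≤ r :=
  (IsUltrametricDist.norm_add_le_max x y).trans (max_le hx hy)

theorem norm_add_lt_of_lt {x y : F} {r : ℝ} (hx : ‖x‖ < r) (hy : ‖y‖ < r) : ‖x + y‖ < r :=
  (IsUltrametricDist.norm_add_le_max x y).trans_lt (max_lt hx hy)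

theorem norm_sub_lt_of_lt {x y : F} {r : ℝ} (hx : ‖x‖ < r) (hy : ‖y‖ < r) : ‖x - y‖ < r := by
  rw [sub_eq_add_neg]
  exact norm_add_lt_of_lt hx (by rwa [norm_neg])

theorem norm_eq_of_norm_sub_lt {x y : F} (h : ‖x - y‖ < ‖y‖) : ‖x‖ = ‖y‖ := by
  simpa using norm_add_eq_left h

theorem norm_natCast_le (n : ℕ) : ‖(n : F)‖ ≤ 1 := IsUltrametricDist.norm_natCast_le_one F n

theorem norm_two_le : ‖(2 : F)‖ ≤ 1 := by exact_mod_cast norm_natCast_le (F := F) 2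

theorem norm_four {F : Type*} [NontriviallyNormedField F] : ‖(4 : F)‖ = ‖(2 : F)‖ ^ 2 := by
  rw [← norm_pow]; norm_num

variable [ProperSpace F]

variable (F) in
-- In an ultrametric space the open unit ball is closed, hence compact here, and the norm attains
-- its maximum on it.
theorem exists_isUniformizer : ∃ ϖ : Fˣ, IsUniformizer ϖ := by
  obtain ⟨x, hx0, hx1⟩ := NormedField.exists_norm_lt_one F
  have hc : IsCompact (Metric.ball (0 : F) 1) :=
    (isCompact_closedBall (0 : F) 1).of_isClosed_subset (IsUltrametricDist.isClosed_ball _ _)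
      Metric.ball_subset_closedBall
  obtain ⟨p, hp, hmax⟩ := hc.exists_isMaxOn ⟨x, by simpa using hx1⟩ continuous_norm.continuousOn
  have h0 : 0 < ‖p‖ := hx0.trans_le (hmax (by simpa using hx1))
  exact ⟨Units.mk0 p (norm_pos_iff.1 h0), by simpa using hp, fun y hy => hmax (by simpa using hy)⟩

theorem IsUniformizer.exists_zpow {F : Type*} [NontriviallyNormedField F] {ϖ : Fˣ} (h : IsUniformizer ϖ) (a : Fˣ) :
    ∃ k : ℤ, ‖(a : F)‖ = ‖(ϖ : F)‖ ^ k := by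
  have h0 : 0 < ‖(ϖ : F)‖ := norm_pos_iff.2 ϖ.ne_zero
  have ha : 0 < ‖(a : F)‖ := norm_pos_iff.2 a.ne_zero
  obtain ⟨k, h1, h2⟩ := exists_mem_Ioc_zpow ha ((one_lt_inv₀ h0).2 h.1)
  have h3 : ‖(a : F) * ϖ ^ (k + 1)‖ ≤ 1 := by
    rw [norm_mul, norm_zpow]
    rw [inv_zpow] at h2
    rwa [le_inv_comm₀ ha (zpow_pos h0 _), ← one_div, le_div_iff₀ ha, mul_comm] at h2
  have h4 : ¬ ‖(a : F) * ϖ ^ (k + 1)‖ < 1 := fun hlt => by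
    have := h.2 _ hlt
    rw [norm_mul, norm_zpow, zpow_add_one₀ h0.ne', ← mul_assoc] at this
    have h5 := le_of_mul_le_mul_right (this.trans_eq (one_mul _).symm) h0
    rw [inv_zpow, inv_lt_comm₀ (zpow_pos h0 _) ha, ← one_div, div_lt_iff₀ ha, mul_comm] at h1
    exact absurd h5 (not_le.2 h1)
  have h5 := le_antisymm h3 (not_lt.1 h4)
  refine ⟨-(k + 1), ?_⟩
  rw [norm_mul, norm_zpow] at h5
  rw [zpow_neg]
  exact eq_inv_of_mul_eq_one_left h5

end LocalField

/-! ### Quadratic equations over the finite residue field -/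

section Residue

variable {F : Type*} [NontriviallyNormedField F] [IsUltrametricDist F] [ProperSpace F]

variable (F) in
/-- An irreducible Artin–Schreier polynomial over the residue field. -/
theorem exists_norm_artinSchreier_eq_one :
    ∃ u : F, ‖u‖ ≤ 1 ∧ ∀ t : F, ‖t‖ ≤ 1 → ‖t ^ 2 + t + u‖ = 1 := by
  obtain ⟨k, _, _, O, r, hr, hO, hr0⟩ := exists_finite_residue_ring F
  by_contra hcon
  push Not at hcon
  have hsurj : Function.Surjective fun x : k => x ^ 2 + x := fun y => by
    obtain ⟨u, hu⟩ := hr (-y)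
    obtain ⟨t, ht, hne⟩ := hcon u ((hO _).1 u.2)
    have hle : ‖t ^ 2 + t + u‖ ≤ 1 :=
      (hO _).1 (O.add_mem (O.add_mem (O.pow_mem ((hO _).2 ht) 2) ((hO _).2 ht)) u.2)
    have h0 := (hr0 (⟨t, (hO t).2 ht⟩ ^ 2 + ⟨t, (hO t).2 ht⟩ + u)).2 (lt_of_le_of_ne hle hne)
    rw [map_add, map_add, map_pow, hu] at h0
    exact ⟨_, add_neg_eq_zero.1 h0⟩
  -- On a finite field `x² + x` cannot be surjective, because it vanishes at both `0` and `-1`.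
  have hinj := Finite.injective_iff_surjective.2 hsurj
  have : (0 : k) = -1 := hinj (by simp)
  simp at this

/-- In residual characteristic two, squaring is injective, hence bijective, on the residue field. -/
theorem exists_norm_sub_sq_lt (h2 : ‖(2 : F)‖ < 1) {d : F} (hd : ‖d‖ ≤ 1) :
    ∃ e : F, ‖e‖ ≤ 1 ∧ ‖d - e ^ 2‖ < 1 := by
  obtain ⟨k, _, _, O, r, hr, hO, hr0⟩ := exists_finite_residue_ring F
  have hk : (2 : k) = 0 := by
    have := (hr0 2).2 h2
    rwa [map_ofNat] at this
  have hinj : Function.Injective fun x : k => x ^ 2 := fun x y (hxy : x ^ 2 = y ^ 2) => by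
    have h : (x - y) ^ 2 = 0 := by linear_combination hxy + (y ^ 2 - x * y) * hk
    exact sub_eq_zero.1 (pow_eq_zero_iff (two_ne_zero) |>.1 h)
  obtain ⟨x, hx⟩ := Finite.injective_iff_surjective.1 hinj (r ⟨d, (hO d).2 hd⟩)
  obtain ⟨e, rfl⟩ := hr x
  refine ⟨e, (hO _).1 e.2, ?_⟩
  exact (hr0 (⟨d, (hO d).2 hd⟩ - e ^ 2)).1 (by rw [map_sub, map_pow, ← hx, sub_self])

/-- Over a finite field of odd characteristic a nondegenerate binary quadratic form represents every
element. -/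
theorem exists_norm_sq_sub_lt (h2 : ‖(2 : F)‖ = 1) {c v : F} (hc : ‖c‖ = 1) (hv : ‖v‖ ≤ 1) :
    ∃ z y : F, ‖z‖ ≤ 1 ∧ ‖y‖ ≤ 1 ∧ ‖z ^ 2 - c * y ^ 2 - v‖ < 1 := by
  obtain ⟨k, _, _, O, r, hr, hO, hr0⟩ := exists_finite_residue_ring F
  have : Fintype k := Fintype.ofFinite k
  have hk : ringChar k ≠ 2 := fun h => by
    have h20 : (2 : k) = 0 := by
      have := ringChar.Nat.cast_ringChar (R := k)
      rw [h] at this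
      exact_mod_cast this
    have : ‖(2 : F)‖ < 1 := (hr0 2).1 (by rw [map_ofNat, h20])
    exact this.ne h2
  set c' : O := ⟨c, (hO c).2 hc.le⟩
  set v' : O := ⟨v, (hO v).2 hv⟩
  have hc0 : r c' ≠ 0 := fun h => by
    have := (hr0 _).1 h
    simp [c', hc] at this
  obtain ⟨a, b, hab⟩ := FiniteField.exists_root_sum_quadratic
    (f := (Polynomial.X ^ 2 : Polynomial k))
    (g := Polynomial.C (- r c') * Polynomial.X ^ 2 + Polynomial.C 0 * Polynomial.X +
      Polynomial.C (- r v'))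
    (Polynomial.degree_X_pow 2) (Polynomial.degree_quadratic (neg_ne_zero.2 hc0))
    (FiniteField.odd_card_of_char_ne_two hk)
  obtain ⟨z, rfl⟩ := hr a
  obtain ⟨y, rfl⟩ := hr b
  refine ⟨z, y, (hO _).1 z.2, (hO _).1 y.2, ?_⟩
  refine (hr0 (z ^ 2 - c' * y ^ 2 - v')).1 ?_
  simp only [map_sub, map_mul, map_pow]
  simp at hab
  linear_combination hab

end Residue

theorem IsUniformizer.not_exists_norm_eq_sq {F : Type*} [NontriviallyNormedField F] {ϖ : Fˣ} (h : IsUniformizer ϖ) :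
    ¬ ∃ z : F, ‖(ϖ : F)‖ = ‖z‖ ^ 2 := by
  rintro ⟨z, hz⟩
  have h0 : 0 < ‖(ϖ : F)‖ := norm_pos_iff.2 ϖ.ne_zero
  have hz0 : z ≠ 0 := by
    rintro rfl
    simp at hz
  obtain ⟨k, hk⟩ := h.exists_zpow (Units.mk0 z hz0)
  rw [Units.val_mk0] at hk
  rw [hk, ← zpow_natCast, ← zpow_mul] at hz
  have := zpow_right_injective₀ h0 h.1.ne ((zpow_one _).trans hz)
  push_cast at this
  omega

/-! ### Norms from the unramified quadratic extension, quadratic defect, and nondegeneracy of the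
symbol -/

section LocalSquares

variable {F : Type*} [NontriviallyNormedField F] [IsUltrametricDist F]

/-- This is the norm form of the unramified quadratic extension. It stays anisotropic modulo the
maximal ideal, so no cancellation occurs; the Artin–Schreier shape makes this work in residual
characteristic two as well. -/
theorem norm_artinSchreier_form {u : F} (hu : ‖u‖ ≤ 1)
    (h : ∀ t : F, ‖t‖ ≤ 1 → ‖t ^ 2 + t + u‖ = 1) (x y : F) :
    ‖x ^ 2 + x * y + u * y ^ 2‖ = max ‖x‖ ‖y‖ ^ 2 := by
  rcases le_or_gt ‖x‖ ‖y‖ with hxy | hxy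
  · rw [max_eq_right hxy]
    by_cases hy : y = 0
    · subst hy
      have : x = 0 := by simpa using hxy
      simp [this]
    have := h (x / y) (by rw [norm_div]; exact div_le_one_of_le₀ hxy (norm_nonneg _))
    have e : x ^ 2 + x * y + u * y ^ 2 = ((x / y) ^ 2 + x / y + u) * y ^ 2 := by field_simp
    rw [e, norm_mul, this, one_mul, norm_pow]
  · rw [max_eq_left hxy.le, add_assoc, ← norm_pow]
    apply norm_add_eq_left
    have hx : 0 < ‖x‖ := (norm_nonneg _).trans_lt hxy
    have h1 : ‖x * y‖ < ‖x ^ 2‖ := by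
      rw [norm_mul, norm_pow, sq]; exact mul_lt_mul_of_pos_left hxy hx
    have h2 : ‖u * y ^ 2‖ < ‖x ^ 2‖ := by
      rw [norm_mul, norm_pow, norm_pow]
      calc ‖u‖ * ‖y‖ ^ 2 ≤ 1 * ‖y‖ ^ 2 := by gcongr
        _ = ‖y‖ ^ 2 := one_mul _
        _ < ‖x‖ ^ 2 := by gcongr
    exact norm_add_lt_of_lt h1 h2

/-- Norms from the unramified quadratic extension have even order. -/
theorem exists_norm_eq_sq_of_hilbert_eq_one [CharZero F] {u : F} (hu : ‖u‖ ≤ 1)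
    (h : ∀ t : F, ‖t‖ ≤ 1 → ‖t ^ 2 + t + u‖ = 1) {c a : Fˣ} (hc : (c : F) = 1 - 4 * u)
    (hca : hilbert c a = 1) : ∃ z : F, ‖(a : F)‖ = ‖z‖ ^ 2 := by
  obtain ⟨x, y, z, h0, e⟩ := hilbert_eq_one_iff.1 hca
  -- The substitution turns `z² - (1 - 4u) x²` into the Artin–Schreier form.
  have e1 : (z - x) ^ 2 + (z - x) * (2 * x) + u * (2 * x) ^ 2 = a * y ^ 2 := by
    rw [hc] at e
    linear_combination e
  have e2 := congrArg norm e1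
  rw [norm_artinSchreier_form hu h] at e2
  by_cases hy : y = 0
  · subst hy
    have h3 : max ‖z - x‖ ‖2 * x‖ = 0 := by simpa using e2
    have h4 : ‖2 * x‖ = 0 := le_antisymm ((le_max_right _ _).trans h3.le) (norm_nonneg _)
    have h5 : ‖z - x‖ = 0 := le_antisymm ((le_max_left _ _).trans h3.le) (norm_nonneg _)
    have hx : x = 0 := by simpa using h4
    subst hx
    have hz : z = 0 := by simpa using h5
    simp_all
  · have hy' : ‖y‖ ≠ 0 := by simpa using hy
    rw [norm_mul _ (y ^ 2), norm_pow] at e2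
    rcases max_choice ‖z - x‖ ‖2 * x‖ with hm | hm <;> rw [hm] at e2
    · exact ⟨(z - x) / y, by rw [norm_div, div_pow, e2]; field_simp⟩
    · exact ⟨(2 * x) / y, by rw [norm_div, div_pow, e2]; field_simp⟩

/-- A unit has a multiple by a unit square which is as close to `1` as possible. -/
theorem exists_minimal_defect [ProperSpace F] (c : F) :
    ∃ s : F, ‖s‖ = 1 ∧ ∀ r : F, ‖r‖ = 1 → ‖c * s ^ 2 - 1‖ ≤ ‖c * s ^ 2 - r ^ 2‖ ∧
      ‖c * s ^ 2 - 1‖ ≤ ‖c * r ^ 2 - 1‖ := by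
  have hf : Continuous fun s : F => ‖c * s ^ 2 - 1‖ := by fun_prop
  obtain ⟨s, hs, hmin⟩ := (isCompact_sphere (0 : F) 1).exists_isMinOn ⟨1, by simp⟩
    hf.continuousOn
  have hs1 : ‖s‖ = 1 := by simpa using hs
  refine ⟨s, hs1, fun r hr => ⟨?_, hmin (by simpa using hr)⟩⟩
  have hr0 : r ≠ 0 := norm_ne_zero_iff.1 (by rw [hr]; exact one_ne_zero)
  have h1 : ‖c * s ^ 2 - 1‖ ≤ ‖c * (s / r) ^ 2 - 1‖ := hmin (by simp [hs1, hr])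
  have h2 : c * s ^ 2 - r ^ 2 = (c * (s / r) ^ 2 - 1) * r ^ 2 := by field_simp
  rw [h2, norm_mul, norm_pow, hr]
  simpa using h1

/-- The local square theorem. -/
theorem isSquare_of_norm_sub_one_lt [ProperSpace F] [CharZero F] {c : F}
    (hc : ‖c - 1‖ < ‖(4 : F)‖) : IsSquare c := by
  have h40 : 0 < ‖(4 : F)‖ := norm_pos_iff.2 (by norm_num)
  have h20 : 0 < ‖(2 : F)‖ := norm_pos_iff.2 (by norm_num)
  obtain ⟨s, hs, hmin⟩ := exists_minimal_defect c
  have hs0 : s ≠ 0 := norm_ne_zero_iff.1 (by rw [hs]; exact one_ne_zero)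
  set d := c * s ^ 2 - 1 with hd
  have hd4 : ‖d‖ < ‖(4 : F)‖ := lt_of_le_of_lt (by simpa using (hmin 1 (by simp)).2) hc
  by_cases hd0 : d = 0
  · refine ⟨1 / s, ?_⟩
    field_simp
    linear_combination hd0
  exfalso
  have hdp : 0 < ‖d‖ := norm_pos_iff.2 hd0
  have hd2 : ‖d / 2‖ < 1 := by
    rw [norm_div, div_lt_one h20]
    refine hd4.trans_le ?_
    rw [norm_four, sq]
    exact mul_le_of_le_one_left h20.le norm_two_le
  -- A Newton step: dividing by `(1 + d/2)²` replaces the defect `d` by one of size `‖d²/4‖ < ‖d‖`,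
  -- against minimality.
  have h1 := (hmin (1 + d / 2) (by rw [norm_add_eq_left (by rwa [norm_one]), norm_one])).1
  have h2 : c * s ^ 2 - (1 + d / 2) ^ 2 = -(d * (d / 4)) := by
    rw [hd]; ring
  rw [h2, norm_neg, norm_mul, norm_div] at h1
  have h3 : ‖d‖ / ‖(4 : F)‖ < 1 := (div_lt_one h40).2 hd4
  nlinarith

theorem norm_one_sub_four_mul {u : F} (hu : ‖u‖ ≤ 1)
    (h : ∀ t : F, ‖t‖ ≤ 1 → ‖t ^ 2 + t + u‖ = 1) : ‖1 - 4 * u‖ = 1 := by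
  have h1 := norm_artinSchreier_form hu h (-1) 2
  rw [norm_neg, norm_one, max_eq_left norm_two_le, ← norm_neg] at h1
  rw [show 1 - 4 * u = -((-1) ^ 2 + -1 * 2 + u * 2 ^ 2) by ring, h1, one_pow]

theorem norm_eq_one_of_norm_sub_sq_lt {c r : F} (hc : ‖c‖ = 1) (h : ‖c - r ^ 2‖ < 1) :
    ‖r‖ = 1 := by
  have h1 : ‖r ^ 2‖ = ‖c‖ := norm_eq_of_norm_sub_lt (by rwa [hc, ← norm_neg, neg_sub])
  rw [hc, norm_pow] at h1
  exact (pow_eq_one_iff_of_nonneg (norm_nonneg _) two_ne_zero).1 h1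

variable [ProperSpace F] [CharZero F]

/-- Nondegeneracy of the quadratic Hilbert symbol. -/
theorem exists_hilbert_ne_one {c : Fˣ} (hc : ¬ IsSquare (c : F)) : ∃ a, hilbert c a ≠ 1 := by
  obtain ⟨ϖ, hϖ⟩ := exists_isUniformizer F
  obtain ⟨u, hu, hform⟩ := exists_norm_artinSchreier_eq_one F
  have hΔ := norm_one_sub_four_mul hu hform
  have hΔ0 : 1 - 4 * u ≠ 0 := norm_ne_zero_iff.1 (by rw [hΔ]; exact one_ne_zero)
  have h40 : (4 : F) ≠ 0 := by norm_num
  have h4p : 0 < ‖(4 : F)‖ := norm_pos_iff.2 h40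
  have h41 : ‖(4 : F)‖ ≤ 1 := by exact_mod_cast norm_natCast_le (F := F) 4
  by_cases hcz : ∃ z : F, ‖(c : F)‖ = ‖z‖ ^ 2
  swap
  -- An element of odd order is not a norm from the unramified extension, so it pairs nontrivially
  -- with `1 - 4u`.
  · refine ⟨Units.mk0 _ hΔ0, fun h => hcz ?_⟩
    rw [hilbert_comm] at h
    exact exists_norm_eq_sq_of_hilbert_eq_one hu hform rfl h
  obtain ⟨z, hz⟩ := hcz
  have hz0 : z ≠ 0 := by
    rintro rfl
    simp at hz
  -- When the order is even, `c` is replaced by a unit in its square class with smallest possible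
  -- defect `d = c - 1`.
  obtain ⟨s, hs, hmin⟩ := exists_minimal_defect ((c : F) * (z⁻¹) ^ 2)
  have hs0 : s ≠ 0 := norm_ne_zero_iff.1 (by rw [hs]; exact one_ne_zero)
  set v : Fˣ := Units.mk0 (z⁻¹ * s) (mul_ne_zero (inv_ne_zero hz0) hs0) with hv
  have hcv : (c : F) * z⁻¹ ^ 2 * s ^ 2 = (c * v ^ 2 : Fˣ) := by
    rw [hv]; push_cast [Units.val_mk0]; ring
  rw [hcv] at hmin
  have hsymb : ∀ a, hilbert c a = hilbert (c * v ^ 2) a := fun a =>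
    (hilbert_mul_sq_left c a v).symm
  have hc1 : ¬ IsSquare ((c * v ^ 2 : Fˣ) : F) := by
    rw [isSquare_coe_iff] at hc ⊢
    rintro ⟨r, hr⟩
    exact hc ⟨r / v, by rw [div_pow, ← hr]; simp⟩
  have hn1 : ‖((c * v ^ 2 : Fˣ) : F)‖ = 1 := by
    rw [← hcv, norm_mul, norm_mul, norm_pow, norm_pow, norm_inv, hs, hz]
    have : ‖z‖ ≠ 0 := norm_ne_zero_iff.2 hz0
    field_simp
  simp only [hsymb]
  generalize c * v ^ 2 = c at *
  replace hmin : ∀ r : F, ‖r‖ = 1 → ‖(c : F) - 1‖ ≤ ‖(c : F) - r ^ 2‖ := fun r hr => (hmin r hr).1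
  obtain ⟨d, hd⟩ : ∃ d, (c : F) - 1 = d := ⟨_, rfl⟩
  rw [hd] at hmin
  have hd1 : ‖d‖ ≤ 1 := by
    rw [← hd, sub_eq_add_neg]
    exact norm_add_le_of_le hn1.le (by simp)
  have hd0 : d ≠ 0 := by
    rintro rfl
    exact hc1 ⟨1, by linear_combination hd⟩
  have hdp : 0 < ‖d‖ := norm_pos_iff.2 hd0
  have hmin' : ∀ r : F, ‖d‖ ≤ ‖(c : F) - r ^ 2‖ := fun r => by
    by_contra hlt
    push Not at hlt
    exact absurd (hmin r (norm_eq_one_of_norm_sub_sq_lt hn1 (hlt.trans_le hd1))) (not_le.2 hlt)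
  -- Below `‖4‖` the unit is a square. At `‖4‖` it generates the unramified extension and pairs
  -- nontrivially with a uniformizer. Above `‖4‖` the residual characteristic is two and the defect
  -- has odd order.
  rcases lt_trichotomy ‖d‖ ‖(4 : F)‖ with hlt | heq | hgt
  · exact absurd (isSquare_of_norm_sub_one_lt (hd ▸ hlt)) hc1
  · refine ⟨ϖ, fun h => hϖ.not_exists_norm_eq_sq ?_⟩
    have hu' : ‖-d / 4‖ = 1 := by rw [norm_div, norm_neg, heq, div_self h4p.ne']
    refine exists_norm_eq_sq_of_hilbert_eq_one (u := -d / 4) hu'.le (fun t ht => ?_) ?_ h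
    · refine le_antisymm ?_ ?_
      · refine norm_add_le_of_le (norm_add_le_of_le ?_ ht) hu'.le
        rw [norm_pow]
        exact pow_le_one₀ (norm_nonneg _) ht
      · have h1 := hmin' (1 + 2 * t)
        have h2 : (c : F) - (1 + 2 * t) ^ 2 = -(4 * (t ^ 2 + t + -d / 4)) := by
          rw [← hd]; ring
        rw [h2, norm_neg, norm_mul, heq] at h1
        exact le_of_mul_le_mul_left (by simpa using h1) h4p
    · rw [← hd]; ring
  -- If `‖d‖ = ‖z‖²`, then `d / z²` is congruent to a square `e²`, and `(1 + z e)²` approximates `c`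
  -- better than `1` does.
  · have hodd : ¬ ∃ z : F, ‖d‖ = ‖z‖ ^ 2 := by
      rintro ⟨z, hz⟩
      have hz0 : z ≠ 0 := by
        rintro rfl
        simp [hd0] at hz
      have hzp : 0 < ‖z‖ := norm_pos_iff.2 hz0
      have h2z : ‖(2 : F)‖ < ‖z‖ := by
        rw [norm_four, hz] at hgt
        exact lt_of_pow_lt_pow_left₀ 2 (norm_nonneg _) hgt
      have h2lt : ‖(2 : F)‖ < 1 := by
        refine h2z.trans_le ?_
        rw [hz] at hd1
        exact (pow_le_one_iff_of_nonneg (norm_nonneg _) two_ne_zero).1 hd1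
      obtain ⟨e, he1, he⟩ := exists_norm_sub_sq_lt h2lt (d := d / z ^ 2)
        (by rw [norm_div, norm_pow, hz, div_self (pow_pos hzp 2).ne'])
      refine absurd (hmin' (1 + z * e)) (not_le.2 ?_)
      have h3 : (c : F) - (1 + z * e) ^ 2 = (d / z ^ 2 - e ^ 2) * z ^ 2 - 2 * e * z := by
        rw [← hd]; field_simp; ring
      rw [h3, hz]
      refine norm_sub_lt_of_lt ?_ ?_
      · rw [norm_mul, norm_pow]
        exact mul_lt_of_lt_one_left (pow_pos hzp 2) he
      · rw [norm_mul, norm_mul, sq]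
        refine mul_lt_mul_of_pos_right ((mul_le_of_le_one_right (norm_nonneg _) he1).trans_lt h2z)
          hzp
    have hq : ‖4 * u / d‖ < 1 := by
      rw [norm_div, norm_mul, div_lt_one hdp]
      exact (mul_le_of_le_one_right (norm_nonneg _) hu).trans_lt hgt
    have hb1 : ‖1 + 4 * u / d‖ = 1 := by
      rw [norm_add_eq_left (by rwa [norm_one]), norm_one]
    have hb0 : 1 + 4 * u / d ≠ 0 := norm_ne_zero_iff.1 (by rw [hb1]; exact one_ne_zero)
    -- With `b = 1 + 4u/d`, suppose `(c, b) = 1`. Since `c - d = 1`, also `(c, -d) = 1`, hence `(c,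
    -- -d b) = 1`. But `c - d b = 1 - 4u`, so `(1 - 4u, c d b) = 1`, and `d` would have even order
    -- because `c` and `b` are units.
    refine ⟨Units.mk0 _ hb0, fun h => hodd ?_⟩
    have h1 : hilbert c (-Units.mk0 d hd0) = 1 :=
      hilbert_of_add_eq_one (by simp [← hd])
    have h2 := hilbert_mul_eq_one hc1 h1 h
    have h3 := hilbert_add_neg_mul (s := Units.mk0 _ hΔ0) (by
      push_cast [Units.val_mk0]
      field_simp
      linear_combination -hd) h2
    obtain ⟨w, hw⟩ := exists_norm_eq_sq_of_hilbert_eq_one hu hform rfl h3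
    refine ⟨w, ?_⟩
    rw [← hw]
    simp [hn1, hb1]

theorem mem_squares_of_hilbert_eq_one {c : Fˣ} (h : ∀ a, hilbert a c = 1) : c ∈ squares F := by
  rw [mem_squares_iff, ← isSquare_coe_iff]
  by_contra hc
  obtain ⟨a, ha⟩ := exists_hilbert_ne_one hc
  exact ha (by rw [hilbert_comm, h])

/-! ### The Hilbert symbol on units in odd residual characteristic -/

section OddResidue

theorem isSquare_of_norm_sub_sq_lt (h2 : ‖(2 : F)‖ = 1) {c r : F} (hc : ‖c‖ = 1)
    (h : ‖c - r ^ 2‖ < 1) : IsSquare c := by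
  have hr := norm_eq_one_of_norm_sub_sq_lt hc h
  have hr0 : r ≠ 0 := norm_ne_zero_iff.1 (by rw [hr]; exact one_ne_zero)
  have h1 : IsSquare (c / r ^ 2) := by
    apply isSquare_of_norm_sub_one_lt
    have : c / r ^ 2 - 1 = (c - r ^ 2) / r ^ 2 := by field_simp
    rw [this, norm_div, norm_pow, hr, norm_four, h2]
    simpa using h
  obtain ⟨s, hs⟩ := h1
  exact ⟨s * r, by field_simp at hs; rw [hs]; ring⟩

theorem hilbert_eq_one_of_norm_eq_one (h2 : ‖(2 : F)‖ = 1) {a c : Fˣ} (ha : ‖(a : F)‖ = 1)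
    (hc : ‖(c : F)‖ = 1) : hilbert a c = 1 := by
  rw [hilbert_eq_one_iff]
  obtain ⟨z, y, hz, hy, h⟩ := exists_norm_sq_sub_lt h2 hc ha.le
  -- A solution of `z² - c y² = a` modulo the maximal ideal is lifted by correcting a unit: `-a/c`
  -- near `y²` when `z` is not a unit, and `a + c y²` near `z²` otherwise.
  rcases hz.lt_or_eq with hz | hz
  · have h1 : ‖-(a : F) / c - y ^ 2‖ < 1 := by
      have e : -(a : F) / c - y ^ 2 = (z ^ 2 - c * y ^ 2 - a - z ^ 2) / c := by
        field_simp; ring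
      rw [e, norm_div, hc, div_one]
      refine norm_sub_lt_of_lt h ?_
      rw [norm_pow]
      exact pow_lt_one₀ (norm_nonneg _) hz two_ne_zero
    obtain ⟨r, hr⟩ := isSquare_of_norm_sub_sq_lt h2 (by simp [ha, hc]) h1
    refine ⟨1, r, 0, by simp, ?_⟩
    field_simp at hr
    linear_combination hr
  · have h1 : ‖(a : F) + c * y ^ 2 - z ^ 2‖ < 1 := by
      rwa [show (a : F) + c * y ^ 2 - z ^ 2 = -(z ^ 2 - c * y ^ 2 - a) by ring, norm_neg]
    have h3 : ‖(a : F) + c * y ^ 2‖ = 1 := by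
      have h4 : ‖z ^ 2‖ = 1 := by rw [norm_pow, hz, one_pow]
      rw [← h4]
      exact norm_eq_of_norm_sub_lt (by rwa [h4])
    obtain ⟨r, hr⟩ := isSquare_of_norm_sub_sq_lt h2 h3 h1
    exact ⟨1, y, r, by simp, by linear_combination -hr⟩

/-- A nonsquare unit `c` generates the unramified extension: writing `c = 1 - 4u`, a nonunit value
`t² + t + u` would put `c` close to `(1 + 2t)²` and make it a square. -/
theorem hilbert_ne_one_of_odd (h2 : ‖(2 : F)‖ = 1) {a c : Fˣ} (hc : ‖(c : F)‖ = 1)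
    (hsq : ¬ IsSquare (c : F)) (ha : ¬ ∃ z : F, ‖(a : F)‖ = ‖z‖ ^ 2) : hilbert c a ≠ 1 := by
  intro h
  have h4 : ‖(4 : F)‖ = 1 := by rw [norm_four, h2, one_pow]
  have hu : ‖(1 - (c : F)) / 4‖ ≤ 1 := by
    rw [norm_div, h4, div_one, sub_eq_add_neg]
    exact norm_add_le_of_le (by simp) (by simp [hc])
  refine ha (exists_norm_eq_sq_of_hilbert_eq_one hu (fun t ht => ?_) (by ring) h)
  refine le_antisymm ?_ (not_lt.1 fun hlt => hsq ?_)
  · refine norm_add_le_of_le (norm_add_le_of_le ?_ ht) hu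
    rw [norm_pow]
    exact pow_le_one₀ (norm_nonneg _) ht
  · refine isSquare_of_norm_sub_sq_lt h2 hc (r := 1 + 2 * t) ?_
    have e : (c : F) - (1 + 2 * t) ^ 2 = -(4 * (t ^ 2 + t + (1 - c) / 4)) := by ring
    rwa [e, norm_neg, norm_mul, h4, one_mul]

variable (F) in
theorem exists_norm_eq_one_not_isSquare :
    ∃ c : Fˣ, ‖(c : F)‖ = 1 ∧ ¬ IsSquare (c : F) := by
  obtain ⟨ϖ, hϖ⟩ := exists_isUniformizer F
  obtain ⟨u, hu, hform⟩ := exists_norm_artinSchreier_eq_one F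
  have hΔ := norm_one_sub_four_mul hu hform
  have hΔ0 : 1 - 4 * u ≠ 0 := norm_ne_zero_iff.1 (by rw [hΔ]; exact one_ne_zero)
  refine ⟨Units.mk0 _ hΔ0, hΔ, fun hs => hϖ.not_exists_norm_eq_sq ?_⟩
  obtain ⟨s, hs⟩ := isSquare_coe_iff.1 hs
  exact exists_norm_eq_sq_of_hilbert_eq_one (c := Units.mk0 _ hΔ0) hu hform rfl
    (by rw [hs, hilbert_sq_left])

end OddResidue

end LocalSquares

/-! ### Rao's function `x` is well defined modulo squares -/

section Rao

variable {n : ℕ} {F : Type*} [Field F]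

/-- The coordinate projection onto the coordinates in `S`. -/
def coordProj (F : Type*) [Field F] (S : Finset (Fin n)) : Matrix (Fin n) (Fin n) F :=
  Matrix.diagonal fun i => if i ∈ S then 1 else 0

theorem coordProj_mul_self (S : Finset (Fin n)) : coordProj F S * coordProj F S = coordProj F S := by
  simp [coordProj, Matrix.diagonal_mul_diagonal]

theorem coordProj_transpose (S : Finset (Fin n)) : (coordProj F S)ᵀ = coordProj F S := by
  simp [coordProj]

theorem rank_coordProj (S : Finset (Fin n)) : (coordProj F S).rank = S.card := by
  rw [coordProj, Matrix.rank_diagonal]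
  simp

theorem tau_eq (S : Finset (Fin n)) : tau S =
    Matrix.fromBlocks (1 - coordProj F S) (-coordProj F S) (coordProj F S) (1 - coordProj F S) := by
  unfold tau coordProj
  rw [← Matrix.diagonal_one, Matrix.diagonal_sub, Matrix.diagonal_neg]
  congr 2 <;> ext i <;> split_ifs <;> simp

theorem exists_perm_coordProj {S T : Finset (Fin n)} (h : S.card = T.card) :
    ∃ W : Matrix (Fin n) (Fin n) F, Wᵀ * W = 1 ∧ W * coordProj F S = coordProj F T * W := by
  obtain ⟨σ, hσ⟩ : ∃ σ : Equiv.Perm (Fin n), ∀ i, σ i ∈ S ↔ i ∈ T := by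
    have e : {i // i ∈ T} ≃ {i // i ∈ S} := Fintype.equivOfCardEq (by simp [h])
    refine ⟨e.extendSubtype, fun i => ⟨fun hi => ?_, fun hi => e.extendSubtype_mem i hi⟩⟩
    by_contra hT
    exact e.extendSubtype_not_mem i hT hi
  refine ⟨σ.toPEquiv.toMatrix, ?_, ?_⟩
  · rw [← PEquiv.toMatrix_symm, ← PEquiv.toMatrix_trans, ← Equiv.toPEquiv_symm,
      ← Equiv.toPEquiv_trans]
    simp
  · ext i j
    rw [coordProj, coordProj, Matrix.mul_diagonal, Matrix.diagonal_mul]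
    simp only [PEquiv.toMatrix_apply, Equiv.toPEquiv_apply, Option.mem_some_iff]
    by_cases hij : σ i = j
    · subst hij
      simp [hσ]
    · simp [hij]

theorem det_one_add_proj_mul {P X : Matrix (Fin n) (Fin n) F} (hP : P * P = P) :
    (1 + (1 - P) * X * P).det = 1 := by
  rw [Matrix.det_one_add_mul_comm, ← Matrix.mul_assoc, Matrix.mul_sub, hP, Matrix.mul_one,
    sub_self, Matrix.zero_mul, add_zero, Matrix.det_one]

/-- If `p τ_S = τ_T p'` for `p = (A *; 0 D)` and `p' = (A' *; 0 *)`, then `det A det A'` is a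
square. -/
theorem exists_det_mul_det_eq_sq {A B D A' B' D' : Matrix (Fin n) (Fin n) F}
    {S T : Finset (Fin n)} (hST : S.card = T.card) (hAD : A * Dᵀ = 1)
    (h : Matrix.fromBlocks A B 0 D * tau S = tau T * Matrix.fromBlocks A' B' 0 D') :
    ∃ s : F, A.det * A'.det = s ^ 2 := by
  obtain ⟨W, hW, hWQ⟩ := exists_perm_coordProj (F := F) hST
  rw [tau_eq, tau_eq, Matrix.fromBlocks_multiply, Matrix.fromBlocks_multiply,
    Matrix.fromBlocks_inj] at h
  have hQ := coordProj_mul_self (F := F) S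
  have hP := coordProj_mul_self (F := F) T
  have hQt := coordProj_transpose (F := F) S
  have hPt := coordProj_transpose (F := F) T
  generalize coordProj F S = Q at *
  generalize coordProj F T = P at *
  obtain ⟨h1, -, h2, -⟩ := h
  simp only [Matrix.zero_mul, Matrix.mul_zero, add_zero, zero_add] at h1 h2
  have hDA : Dᵀ * A = 1 := mul_eq_one_comm.1 hAD
  have hAD' : Aᵀ * D = 1 := by
    have := congrArg Matrix.transpose hDA
    simpa using this
  have hQQ : (1 - Q) * (1 - Q) = 1 - Q := by noncomm_ring [hQ]
  have hQ1 : Q * (1 - Q) = 0 := by rw [mul_sub, hQ, mul_one, sub_self]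
  have hQ2 : (1 - Q) * Q = 0 := by rw [sub_mul, hQ, one_mul, sub_self]
  have hP2 : (1 - P) * P = 0 := by rw [sub_mul, hP, one_mul, sub_self]
  have hP1 : P * (1 - P) = 0 := by rw [mul_sub, hP, mul_one, sub_self]
  -- `A (1 - Q) = (1 - P) A' (1 - Q)`
  have h3 : A * (1 - Q) = (1 - P) * A' * (1 - Q) := by
    have := congrArg (· * (1 - Q)) h1
    simpa only [add_mul, mul_assoc, hQQ, hQ1, mul_zero, add_zero] using this
  have hPA : P * (A * (1 - Q)) = 0 := by
    rw [h3, ← mul_assoc, ← mul_assoc, hP1, zero_mul, zero_mul]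
  have hPD : P * (D * Q) = D * Q := by rw [h2, ← mul_assoc, hP]
  -- `M` combines the two known restrictions, `D` on the image of `Q` and `A` on that of `1 - Q`. It
  -- differs from `A'` by a unipotent left factor, so the determinants agree.
  set M := D * Q + A * (1 - Q) with hM
  have hA' : A' = (1 + (1 - P) * (A' * Q * Aᵀ) * P) * M := by
    have e1 : P * M = D * Q := by rw [hM, mul_add, hPA, hPD, add_zero]
    have e2 : A' * Q * Aᵀ * (D * Q) = A' * Q := by
      rw [mul_assoc (A' * Q), ← mul_assoc Aᵀ, hAD', one_mul, mul_assoc, hQ]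
    rw [add_mul, one_mul, mul_assoc, e1, mul_assoc, e2, hM, h2, h3]
    noncomm_ring
  have hdet : A'.det = M.det := by
    rw [hA', Matrix.det_mul, det_one_add_proj_mul hP, one_mul]
  set G := Aᵀ * A with hG
  have hAM : Aᵀ * M = Q + G * (1 - Q) := by
    rw [hM, mul_add, ← mul_assoc, hAD', one_mul, hG, mul_assoc]
  -- Replacing `D` by the permutation matrix `W` gives a matrix whose Gram matrix `Lᵀ L` equals `Aᵀ
  -- M` up to a unipotent factor. Hence `det A det M = (det L)²`.
  set L := W * Q + A * (1 - Q) with hL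
  have hLL : Lᵀ * L = Q + (1 - Q) * G * (1 - Q) := by
    have e1 : (W * Q)ᵀ * (A * (1 - Q)) = 0 := by
      rw [hWQ, Matrix.transpose_mul, hPt, mul_assoc, hPA, mul_zero]
    have e2 : (A * (1 - Q))ᵀ * (W * Q) = 0 := by
      have := congrArg Matrix.transpose e1
      simpa using this
    have e3 : (W * Q)ᵀ * (W * Q) = Q := by
      rw [Matrix.transpose_mul, mul_assoc, ← mul_assoc Wᵀ, hW, one_mul, hQt, hQ]
    have e4 : (A * (1 - Q))ᵀ * (A * (1 - Q)) = (1 - Q) * G * (1 - Q) := by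
      rw [Matrix.transpose_mul, Matrix.transpose_sub, Matrix.transpose_one, hQt, hG]
      simp only [mul_assoc]
    rw [hL, Matrix.transpose_add, add_mul, mul_add, mul_add, e1, e2, e3, e4, add_zero, zero_add]
  have hfin : Aᵀ * M = (Lᵀ * L) * (1 + (1 - (1 - Q)) * G * (1 - Q)) := by
    have e5 : (1 - Q) * G * (1 - Q) * (Q * G * (1 - Q)) = 0 := by
      rw [mul_assoc Q, ← mul_assoc _ Q, mul_assoc _ (1 - Q) Q, hQ2, mul_zero, zero_mul]
    have e6 : Q * (Q * G * (1 - Q)) = Q * G * (1 - Q) := by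
      rw [mul_assoc Q, ← mul_assoc Q Q, hQ]
    rw [hAM, hLL, sub_sub_cancel, mul_add, mul_one, add_mul, e6, e5]
    noncomm_ring
  refine ⟨L.det, ?_⟩
  have := congrArg Matrix.det hfin
  rw [Matrix.det_mul, Matrix.det_mul, Matrix.det_mul, det_one_add_proj_mul hQQ, mul_one,
    Matrix.det_transpose, Matrix.det_transpose] at this
  rw [hdet, this, sq]

theorem IsSiegel.exists_blocks {p : GL (Fin n ⊕ Fin n) F} (h : IsSiegel p) :
    ∃ B D, p.val = Matrix.fromBlocks p.val.toBlocks₁₁ B 0 D ∧ p.val.toBlocks₁₁ * Dᵀ = 1 := by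
  refine ⟨p.val.toBlocks₁₂, p.val.toBlocks₂₂, ?_, ?_⟩
  · rw [← h.2, Matrix.fromBlocks_toBlocks]
  · have h1 := h.1
    unfold IsSymplectic at h1
    have e : p.val = Matrix.fromBlocks p.val.toBlocks₁₁ p.val.toBlocks₁₂ 0 p.val.toBlocks₂₂ := by
      rw [← h.2, Matrix.fromBlocks_toBlocks]
    rw [e] at h1
    simp only [J, Matrix.fromBlocks_multiply, Matrix.fromBlocks_transpose] at h1
    have h2 := (Matrix.fromBlocks_inj.1 h1).2.1
    simpa using h2

theorem IsSymplectic.mul {p q : GL (Fin n ⊕ Fin n) F} (hp : IsSymplectic p)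
    (hq : IsSymplectic q) : IsSymplectic (p * q) := by
  unfold IsSymplectic at *
  have : (p * q).val * J n F * (p * q).valᵀ = p.val * (q.val * J n F * q.valᵀ) * p.valᵀ := by
    simp only [Units.val_mul, Matrix.transpose_mul, Matrix.mul_assoc]
  rw [this, hq, hp]

theorem toBlocks₁₁_mul {A B : Matrix (Fin n ⊕ Fin n) (Fin n ⊕ Fin n) F}
    (hB : B.toBlocks₂₁ = 0) : (A * B).toBlocks₁₁ = A.toBlocks₁₁ * B.toBlocks₁₁ := by
  conv_lhs => rw [← Matrix.fromBlocks_toBlocks A, ← Matrix.fromBlocks_toBlocks B,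
    Matrix.fromBlocks_multiply, Matrix.toBlocks_fromBlocks₁₁, hB, Matrix.mul_zero, add_zero]

theorem toBlocks₂₁_mul (A B : Matrix (Fin n ⊕ Fin n) (Fin n ⊕ Fin n) F) :
    (A * B).toBlocks₂₁ = A.toBlocks₂₁ * B.toBlocks₁₁ + A.toBlocks₂₂ * B.toBlocks₂₁ := by
  conv_lhs => rw [← Matrix.fromBlocks_toBlocks A, ← Matrix.fromBlocks_toBlocks B,
    Matrix.fromBlocks_multiply, Matrix.toBlocks_fromBlocks₂₁]

theorem IsSiegel.mul {p q : GL (Fin n ⊕ Fin n) F} (hp : IsSiegel p) (hq : IsSiegel q) :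
    IsSiegel (p * q) := by
  refine ⟨hp.1.mul hq.1, ?_⟩
  rw [Units.val_mul, toBlocks₂₁_mul, hp.2, hq.2, Matrix.zero_mul, Matrix.mul_zero, add_zero]

theorem IsSiegel.one : IsSiegel (1 : GL (Fin n ⊕ Fin n) F) := by
  refine ⟨by simp [IsSymplectic], ?_⟩
  rw [Units.val_one, ← Matrix.fromBlocks_one, Matrix.toBlocks_fromBlocks₂₁]

theorem mul_mul_eq_of_mul_mul_eq {M : Type*} [Monoid M] {a b c a' b' c' x y : M}
    (h : a * b * c = a' * b' * c') (hc : c * x = 1) (ha : y * a' = 1) :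
    y * a * b = b' * (c' * x) := by
  calc y * a * b = y * (a * b * c) * x := by simp only [mul_assoc, hc, mul_one]
    _ = y * a' * (b' * (c' * x)) := by rw [h]; simp only [mul_assoc]
    _ = b' * (c' * x) := by rw [ha, one_mul]

/-- Moving one Siegel factor of each decomposition across gives `p τ_S = τ_T p'`. Comparing ranks of
lower left blocks yields `|S| = |T|`, and `exists_det_mul_det_eq_sq` applies. As `raoX` is a choice,
this is what makes its square class computable. -/
theorem IsRaoX.exists_eq_mul_sq {g : GL (Fin n ⊕ Fin n) F} {u v : Fˣ} (hu : IsRaoX g u)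
    (hv : IsRaoX g v) : ∃ s, u = v * s ^ 2 := by
  obtain ⟨p₁, p₂, S, h₁, h₂, hg, hu⟩ := hu
  obtain ⟨q₁, q₂, T, k₁, k₂, hg', hv⟩ := hv
  obtain ⟨B₁, D₁, e₁, o₁⟩ := h₁.exists_blocks
  obtain ⟨B₂, D₂, e₂, o₂⟩ := h₂.exists_blocks
  obtain ⟨B₃, D₃, e₃, o₃⟩ := k₁.exists_blocks
  obtain ⟨B₄, D₄, e₄, o₄⟩ := k₂.exists_blocks
  have heq : p₁.val * tau S * p₂.val = q₁.val * tau T * q₂.val := hg.symm.trans hg'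
  generalize p₁.val.toBlocks₁₁ = A₁ at *
  generalize p₂.val.toBlocks₁₁ = A₂ at *
  generalize q₁.val.toBlocks₁₁ = A₃ at *
  generalize q₂.val.toBlocks₁₁ = A₄ at *
  rw [e₁, e₂, e₃, e₄] at heq
  have det_ne : ∀ {A D : Matrix (Fin n) (Fin n) F}, A * Dᵀ = 1 → A.det ≠ 0 ∧ D.det ≠ 0 ∧
      A.det * D.det = 1 := fun {A D} h => by
    have := congrArg Matrix.det h
    rw [Matrix.det_mul, Matrix.det_transpose, Matrix.det_one] at this
    exact ⟨left_ne_zero_of_mul_eq_one this, right_ne_zero_of_mul_eq_one this, this⟩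
  have t₁ : D₁ᵀ * A₁ = 1 := mul_eq_one_comm.1 o₁
  have t₂ : D₂ᵀ * A₂ = 1 := mul_eq_one_comm.1 o₂
  have t₃ : D₃ᵀ * A₃ = 1 := mul_eq_one_comm.1 o₃
  have s₂ : D₂ * A₂ᵀ = 1 := by simpa using congrArg Matrix.transpose o₂
  have s₃ : A₃ᵀ * D₃ = 1 := by simpa using congrArg Matrix.transpose t₃
  have i₂ : Matrix.fromBlocks A₂ B₂ 0 D₂ * Matrix.fromBlocks D₂ᵀ (-(D₂ᵀ * B₂ * A₂ᵀ)) 0 A₂ᵀ = 1 := by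
    rw [Matrix.fromBlocks_multiply, ← Matrix.fromBlocks_one]
    congr 1 <;> simp [o₂, s₂, ← Matrix.mul_assoc]
  have i₃ : Matrix.fromBlocks D₃ᵀ (-(D₃ᵀ * B₃ * A₃ᵀ)) 0 A₃ᵀ * Matrix.fromBlocks A₃ B₃ 0 D₃ = 1 := by
    rw [Matrix.fromBlocks_multiply, ← Matrix.fromBlocks_one]
    congr 1 <;> simp [t₃, s₃, Matrix.mul_assoc]
  have h6 := mul_mul_eq_of_mul_mul_eq heq i₂ i₃
  rw [Matrix.fromBlocks_multiply, Matrix.fromBlocks_multiply] at h6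
  simp only [Matrix.mul_zero, Matrix.zero_mul, add_zero, zero_add] at h6
  have hST : S.card = T.card := by
    have h7 := congrArg Matrix.toBlocks₂₁ h6
    rw [tau_eq, tau_eq, Matrix.fromBlocks_multiply, Matrix.fromBlocks_multiply,
      Matrix.toBlocks_fromBlocks₂₁, Matrix.toBlocks_fromBlocks₂₁] at h7
    simp only [Matrix.mul_zero, Matrix.zero_mul, add_zero, zero_add] at h7
    have h8 := congrArg Matrix.rank h7
    rwa [Matrix.rank_mul_eq_right_of_isUnit_det, Matrix.rank_mul_eq_left_of_isUnit_det,
      rank_coordProj, rank_coordProj] at h8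
    · rw [Matrix.det_mul, Matrix.det_transpose, isUnit_iff_ne_zero]
      exact mul_ne_zero (det_ne o₄).1 (det_ne o₂).2.1
    · rw [Matrix.det_mul, Matrix.det_transpose, isUnit_iff_ne_zero]
      exact mul_ne_zero (det_ne o₃).1 (det_ne o₁).2.1
  obtain ⟨r, hr⟩ := exists_det_mul_det_eq_sq hST (by
    rw [Matrix.transpose_mul, Matrix.transpose_transpose, Matrix.mul_assoc, ← Matrix.mul_assoc A₁,
      o₁, Matrix.one_mul, t₃]) h6
  rw [Matrix.det_mul, Matrix.det_mul, Matrix.det_transpose, Matrix.det_transpose] at hr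
  obtain ⟨a₁, -, -⟩ := det_ne o₁
  obtain ⟨a₂, -, m₂⟩ := det_ne o₂
  obtain ⟨a₃, -, m₃⟩ := det_ne o₃
  obtain ⟨a₄, -, -⟩ := det_ne o₄
  have h9 : (u : F) * v = (r * (A₃.det * A₂.det)) ^ 2 := by
    rw [hu, hv, mul_pow, ← hr]
    linear_combination (A₁.det * A₂.det * A₃.det * A₄.det) * (-1 : F) *
      ((A₂.det * D₂.det) * m₃ + m₂)
  have hw0 : r * (A₃.det * A₂.det) ≠ 0 := by
    intro h0
    rw [h0] at h9
    have : (u : F) * v ≠ 0 := mul_ne_zero u.ne_zero v.ne_zero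
    simp [h9] at this
  refine ⟨Units.mk0 _ hw0 / v, Units.ext ?_⟩
  push_cast [Units.val_div_eq_div_val, Units.val_mk0]
  rw [div_pow, ← h9]
  field_simp

end Rao

/-! ### Rao's cocycle when one argument lies in the torus of `Sp` -/

section TorusSp

variable {n : ℕ} {F : Type*} [Field F]

theorem torus_val_val (t : Fin n → Fˣ) (y : Fˣ) : (torus t y).val.val =
    Matrix.diagonal (Sum.elim (fun i => (t i : F)) fun i => (y * (t i)⁻¹ : F)) := rfl

theorem torus_mul (t t' : Fin n → Fˣ) (y y' : Fˣ) :
    torus t y * torus t' y' = torus (t * t') (y * y') := by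
  refine Subtype.ext (Units.ext ?_)
  rw [Subgroup.coe_mul, Units.val_mul, torus_val_val, torus_val_val, torus_val_val,
    Matrix.diagonal_mul_diagonal]
  congr 1
  ext i
  rcases i with i | i
  · simp
  · simp; ring

theorem torus_one : (torus 1 1 : GSp n F) = 1 := by
  refine Subtype.ext (Units.ext ?_)
  change _ = (1 : Matrix (Fin n ⊕ Fin n) (Fin n ⊕ Fin n) F)
  rw [torus_val_val, ← Matrix.diagonal_one]
  congr 1
  ext i
  rcases i with i | i <;> simp

theorem torus_inv (t : Fin n → Fˣ) (y : Fˣ) : (torus t y)⁻¹ = torus t⁻¹ y⁻¹ := by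
  rw [inv_eq_iff_mul_eq_one, torus_mul, mul_inv_cancel, mul_inv_cancel, torus_one]

theorem torus_inj {t t' : Fin n → Fˣ} {y y' : Fˣ} (hn : 1 ≤ n) :
    torus t y = torus t' y' ↔ t = t' ∧ y = y' := by
  refine ⟨fun h => ?_, fun h => by rw [h.1, h.2]⟩
  have h1 : (torus t y).val.val = (torus t' y').val.val := by rw [h]
  rw [torus_val_val, torus_val_val, Matrix.diagonal_eq_diagonal_iff] at h1
  have ht : t = t' := funext fun i => Units.ext (by simpa using h1 (Sum.inl i))
  refine ⟨ht, Units.ext ?_⟩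
  have h2 := h1 (Sum.inr ⟨0, hn⟩)
  rw [ht] at h2
  simpa using h2

theorem toBlocks_torus (t : Fin n → Fˣ) (y : Fˣ) : (torus t y).val.val =
    Matrix.fromBlocks (Matrix.diagonal fun i => (t i : F)) 0 0
      (Matrix.diagonal fun i => (y * (t i)⁻¹ : F)) := by
  rw [torus_val_val, Matrix.fromBlocks_diagonal]

theorem torus_mem_gSp (t : Fin n → Fˣ) (y : Fˣ) :
    (torus t y).val.val * J n F * (torus t y).val.valᵀ = (y : F) • J n F := by
  rw [toBlocks_torus]
  simp only [J, Matrix.fromBlocks_multiply, Matrix.fromBlocks_transpose, Matrix.fromBlocks_smul]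
  congr 1
  · simp
  · simp only [Matrix.mul_zero, Matrix.mul_one, zero_add, Matrix.transpose_zero, add_zero,
      Matrix.diagonal_transpose, Matrix.diagonal_mul_diagonal, Matrix.mul_neg, neg_zero]
    ext i j
    by_cases h : i = j
    · subst h
      simp
      field_simp
    · simp [h]
  · simp only [Matrix.mul_zero, Matrix.mul_one, zero_add, Matrix.transpose_zero, add_zero,
      Matrix.diagonal_transpose, Matrix.diagonal_mul_diagonal, Matrix.mul_neg,
      Matrix.neg_mul]
    ext i j
    by_cases h : i = j
    · subst h
      simp
    · simp [h]
  · simp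

theorem isSiegel_torus (t : Fin n → Fˣ) : IsSiegel (torus t 1 : GSp n F).val := by
  refine ⟨?_, ?_⟩
  · unfold IsSymplectic
    rw [torus_mem_gSp, Units.val_one, one_smul]
  · rw [toBlocks_torus, Matrix.toBlocks_fromBlocks₂₁]

theorem det_toBlocks_torus (t : Fin n → Fˣ) :
    (torus t 1 : GSp n F).val.val.toBlocks₁₁.det = (∏ i, t i : Fˣ) := by
  rw [toBlocks_torus, Matrix.toBlocks_fromBlocks₁₁, Matrix.det_diagonal]
  simp

theorem IsRaoX.torus_mul_mul {g : GL (Fin n ⊕ Fin n) F} {u : Fˣ} (h : IsRaoX g u)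
    (t t' : Fin n → Fˣ) :
    IsRaoX ((torus t 1).val * g * (torus t' 1).val) ((∏ i, t i) * (∏ i, t' i) * u) := by
  obtain ⟨p₁, p₂, S, h₁, h₂, hg, hu⟩ := h
  refine ⟨(torus t 1).val * p₁, p₂ * (torus t' 1).val, S, (isSiegel_torus t).mul h₁,
    h₂.mul (isSiegel_torus t'), ?_, ?_⟩
  · simp only [Units.val_mul, hg, mul_assoc]
  · rw [Units.val_mul (torus t 1).val, Units.val_mul p₂, toBlocks₁₁_mul h₁.2, toBlocks₁₁_mul (isSiegel_torus t').2,
      Matrix.det_mul, Matrix.det_mul, det_toBlocks_torus, det_toBlocks_torus]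
    push_cast
    rw [hu]
    ring

theorem isRaoX_torus (t : Fin n → Fˣ) : IsRaoX (torus t 1 : GSp n F).val (∏ i, t i) := by
  refine ⟨(torus t 1).val, 1, ∅, isSiegel_torus t, IsSiegel.one, ?_, ?_⟩
  · have : (tau ∅ : Matrix (Fin n ⊕ Fin n) (Fin n ⊕ Fin n) F) = 1 := by
      rw [tau_eq, ← Matrix.fromBlocks_one]
      simp [coordProj]
    rw [this]
    simp
  · rw [det_toBlocks_torus, Units.val_one, ← Matrix.fromBlocks_one, Matrix.toBlocks_fromBlocks₁₁]
    simp

theorem isRaoX_raoX {g : GL (Fin n ⊕ Fin n) F} (h : ∃ u, IsRaoX g u) : IsRaoX g (raoX g) := by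
  rw [raoX, dif_pos h]
  exact Classical.choose_spec h

theorem exists_raoX_torus (t : Fin n → Fˣ) :
    ∃ s, raoX (torus t 1 : GSp n F).val = (∏ i, t i) * s ^ 2 :=
  (isRaoX_raoX ⟨_, isRaoX_torus t⟩).exists_eq_mul_sq (isRaoX_torus t)

/-- The second alternative covers a `g` without a decomposition `p₁ τ_S p₂`: its torus translates
have none either, and `raoX` takes its default value on both. This makes the Bruhat decomposition
unnecessary. -/
theorem raoX_torus_mul_mul (g : GL (Fin n ⊕ Fin n) F) (t t' : Fin n → Fˣ) :
    (∃ s, raoX ((torus t 1).val * g * (torus t' 1).val) =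
      (∏ i, t i) * (∏ i, t' i) * raoX g * s ^ 2) ∨
    (raoX g = 1 ∧ raoX ((torus t 1).val * g * (torus t' 1).val) = 1) := by
  by_cases h : ∃ u, IsRaoX g u
  · have h1 := (isRaoX_raoX h).torus_mul_mul t t'
    exact Or.inl ((isRaoX_raoX ⟨_, h1⟩).exists_eq_mul_sq h1)
  · have h' : ¬ ∃ u, IsRaoX ((torus t 1).val * g * (torus t' 1).val) u := by
      rintro ⟨u, hu⟩
      refine h ⟨(∏ i, t⁻¹ i) * (∏ i, t'⁻¹ i) * u, ?_⟩
      have h1 := hu.torus_mul_mul t⁻¹ t'⁻¹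
      rw [← inv_one, ← torus_inv, ← torus_inv] at h1
      simpa [mul_assoc] using h1
    exact Or.inr ⟨by rw [raoX, dif_neg h], by rw [raoX, dif_neg h']⟩

theorem form_eq_zero_of_mem_Vstar {u v : Fin n ⊕ Fin n → F} (hu : u ∈ Vstar n F)
    (hv : v ∈ Vstar n F) : form u v = 0 := by
  have hu' : ∀ i, u (Sum.inl i) = 0 := hu
  have hv' : ∀ i, v (Sum.inl i) = 0 := hv
  unfold form J
  rw [dotProduct, Fintype.sum_sum_type]
  simp [hv', hu', Matrix.vecMul, dotProduct]

theorem VstarMul_torus (t : Fin n → Fˣ) : VstarMul (torus t 1 : GSp n F).val = Vstar n F := by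
  have hmem : ∀ (t : Fin n → Fˣ) (v : Fin n ⊕ Fin n → F), v ∈ Vstar n F →
      v ᵥ* (torus t 1).val.val ∈ Vstar n F := fun t v hv i => by
    rw [torus_val_val, Matrix.vecMul_diagonal, hv i, zero_mul]
  apply le_antisymm
  · rintro _ ⟨v, hv, rfl⟩
    exact hmem t v hv
  · intro v hv
    refine ⟨v ᵥ* (torus t⁻¹ 1).val.val, hmem _ v hv, ?_⟩
    rw [Matrix.vecMulLinear_apply, Matrix.vecMul_vecMul, ← Units.val_mul, ← Subgroup.coe_mul,
      torus_mul]
    simp [torus_one]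

/-- If one of `a_i`, `b_i` lies in the Lagrangian `V^*`, so does the other, since their sum does.
Then `⟨a_i, b_i⟩ = 0`, which contradicts `d_i ≠ 0`, so the diagonal form is empty. -/
theorem leray_fst_eq_zero {g₁ g₂ : GL (Fin n ⊕ Fin n) F}
    (h : VstarMul g₁ = Vstar n F ∨ VstarMul g₂⁻¹ = Vstar n F) : (leray g₁ g₂).1 = 0 := by
  unfold leray
  split_ifs with hne
  · set D := Classical.choice hne
    by_contra hk
    let i : Fin D.k := ⟨0, Nat.pos_of_ne_zero hk⟩
    have h1 := D.orthogonal i i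
    rw [if_pos rfl] at h1
    refine (D.d i).ne_zero (h1.symm.trans ?_)
    rcases h with h | h
    · have ha : D.a i ∈ Vstar n F := h ▸ D.a_mem i
      refine form_eq_zero_of_mem_Vstar ha ?_
      simpa using (Vstar n F).sub_mem (D.add_mem i) ha
    · have hb : D.b i ∈ Vstar n F := h ▸ D.b_mem i
      refine form_eq_zero_of_mem_Vstar ?_ hb
      simpa using (Vstar n F).sub_mem (D.add_mem i) hb
  · rfl

theorem rao_of_leray_eq_zero {g₁ g₂ : GL (Fin n ⊕ Fin n) F} (h : (leray g₁ g₂).1 = 0)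
    (hc : cell g₁ + cell g₂ = cell (g₁ * g₂)) :
    rao g₁ g₂ = hilbert (raoX g₁) (raoX g₂) * hilbert (-(raoX g₁ * raoX g₂)) (raoX (g₁ * g₂)) := by
  unfold rao
  generalize leray g₁ g₂ = ρ at h
  obtain ⟨k, d⟩ := ρ
  obtain rfl : k = 0 := h
  simp [hc, hilbert_one_left]

theorem cell_torus (t : Fin n → Fˣ) (y : Fˣ) : cell (torus t y : GSp n F).val = 0 := by
  rw [cell, toBlocks_torus, Matrix.toBlocks_fromBlocks₂₁, Matrix.rank_zero]

theorem cell_torus_mul (t : Fin n → Fˣ) (y : Fˣ) (g : GL (Fin n ⊕ Fin n) F) :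
    cell ((torus t y).val * g) = cell g := by
  rw [cell, Units.val_mul, toBlocks₂₁_mul, toBlocks_torus, Matrix.toBlocks_fromBlocks₂₁,
    Matrix.zero_mul, zero_add, Matrix.toBlocks_fromBlocks₂₂, Matrix.rank_mul_eq_right_of_isUnit_det]
  · rfl
  · rw [Matrix.det_diagonal, isUnit_iff_ne_zero, Finset.prod_ne_zero_iff]
    simp

theorem cell_mul_torus (t : Fin n → Fˣ) (y : Fˣ) (g : GL (Fin n ⊕ Fin n) F) :
    cell (g * (torus t y).val) = cell g := by
  rw [cell, Units.val_mul, toBlocks₂₁_mul, toBlocks_torus, Matrix.toBlocks_fromBlocks₂₁,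
    Matrix.mul_zero, add_zero, Matrix.toBlocks_fromBlocks₁₁, Matrix.rank_mul_eq_left_of_isUnit_det]
  · rfl
  · rw [Matrix.det_diagonal, isUnit_iff_ne_zero, Finset.prod_ne_zero_iff]
    simp

/-- By `(-b, b) = 1` the second factor of Rao's formula disappears once `x₁₂ = x₁ x₂` modulo
squares. -/
theorem hilbert_mul_hilbert_neg_mul {a x z : Fˣ}
    (h : (∃ s, z = a * x * s ^ 2) ∨ (x = 1 ∧ z = 1)) :
    hilbert a x * hilbert (-(a * x)) z = hilbert a x := by
  rcases h with ⟨s, rfl⟩ | ⟨rfl, rfl⟩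
  · rw [hilbert_mul_sq_right, hilbert_neg_self, mul_one]
  · rw [hilbert_one_right, hilbert_one_right, one_mul]

theorem rao_torus_left (t : Fin n → Fˣ) (g : GL (Fin n ⊕ Fin n) F) :
    rao (torus t 1).val g = hilbert (∏ i, t i) (raoX g) := by
  rw [rao_of_leray_eq_zero (leray_fst_eq_zero (Or.inl (VstarMul_torus t)))
    (by rw [cell_torus, cell_torus_mul, zero_add])]
  obtain ⟨s, hs⟩ := exists_raoX_torus (F := F) t
  have h := raoX_torus_mul_mul g t 1
  rw [torus_one, Subgroup.coe_one, mul_one] at h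
  rw [hilbert_mul_hilbert_neg_mul, hs, hilbert_mul_sq_left]
  rcases h with ⟨r, hr⟩ | h
  · refine Or.inl ⟨r / s, ?_⟩
    rw [hr, hs]
    simp only [Pi.one_apply, Finset.prod_const_one, mul_one]
    rw [div_pow, mul_right_comm _ (s ^ 2), mul_assoc, mul_assoc, mul_assoc, mul_div_cancel]
  · exact Or.inr h

theorem rao_torus_right (t : Fin n → Fˣ) (g : GL (Fin n ⊕ Fin n) F) :
    rao g (torus t 1).val = hilbert (raoX g) (∏ i, t i) := by
  rw [rao_of_leray_eq_zero (leray_fst_eq_zero (Or.inr ?_))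
    (by rw [cell_torus, cell_mul_torus, add_zero])]
  swap
  · rw [← Subgroup.coe_inv, torus_inv, inv_one, VstarMul_torus]
  obtain ⟨s, hs⟩ := exists_raoX_torus (F := F) t
  have h := raoX_torus_mul_mul g 1 t
  rw [torus_one, Subgroup.coe_one, one_mul] at h
  rw [hilbert_comm, mul_comm (raoX g), hilbert_mul_hilbert_neg_mul, hs, hilbert_mul_sq_left,
    hilbert_comm]
  rcases h with ⟨r, hr⟩ | h
  · refine Or.inl ⟨r / s, ?_⟩
    rw [hr, hs]
    simp only [Pi.one_apply, Finset.prod_const_one, one_mul]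
    rw [div_pow, mul_right_comm _ (s ^ 2), mul_assoc, mul_assoc, mul_assoc, mul_div_cancel]
  · exact Or.inr h

end TorusSp

/-! ### The Weyl group action on the torus -/

section Weyl

variable {n : ℕ} {F : Type*} [Field F]

theorem J_inl_inr (a : Fin n) : J n F (Sum.inl a) (Sum.inr a) = 1 := by
  simp [J]

theorem sim_eq {g : GSp n F} {l : Fˣ} (hn : 1 ≤ n)
    (h : g.val.val * J n F * g.val.valᵀ = (l : F) • J n F) : sim g = l := by
  have h1 : g.val.val * J n F * g.val.valᵀ = (sim g : F) • J n F := Classical.choose_spec g.2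
  have h2 := congrFun (congrFun (h1.symm.trans h) (Sum.inl ⟨0, hn⟩)) (Sum.inr ⟨0, hn⟩)
  rw [Matrix.smul_apply, Matrix.smul_apply, J_inl_inr] at h2
  exact Units.ext (by simpa using h2)

theorem sim_torus (hn : 1 ≤ n) (t : Fin n → Fˣ) (y : Fˣ) : sim (torus t y) = y :=
  sim_eq hn (torus_mem_gSp t y)

theorem IsWeyl.sim_eq_one (hn : 1 ≤ n) {w : GSp n F} (hw : IsWeyl w) : sim w = 1 :=
  sim_eq hn (by rw [Units.val_one, one_smul]; exact hw.1)

theorem spPart_torus (hn : 1 ≤ n) (t : Fin n → Fˣ) (y : Fˣ) :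
    spPart (torus t y) = torus t 1 := by
  rw [spPart, sim_torus hn, iSim, torus_inv, torus_mul]
  simp

theorem IsWeyl.spPart_eq (hn : 1 ≤ n) {w : GSp n F} (hw : IsWeyl w) : spPart w = w := by
  rw [spPart, hw.sim_eq_one hn, iSim, torus_one, inv_one, one_mul]

/-- The action of a signed permutation on the `t`-coordinates of the torus, in similitude
factor `y`. -/
def weylAct (π : Equiv.Perm (Fin n)) (e : Fin n → Prop) (t : Fin n → Fˣ) (y : Fˣ) : Fin n → Fˣ :=
  fun j => if e j then y * (t (π j))⁻¹ else t (π j)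

theorem signedPerm_mul_J_mul_transpose {M : Matrix (Fin n ⊕ Fin n) (Fin n ⊕ Fin n) F}
    {σ : Equiv.Perm (Fin n ⊕ Fin n)} {s : Fin n ⊕ Fin n → ℤˣ}
    (h : ∀ i j, M i j = if j = σ i then ((s i : ℤ) : F) else 0) (i i' : Fin n ⊕ Fin n) :
    (M * J n F * Mᵀ) i i' = ((s i : ℤ) : F) * ((s i' : ℤ) : F) * J n F (σ i) (σ i') := by
  simp only [Matrix.mul_apply, Matrix.transpose_apply, h, ite_mul, mul_ite, zero_mul, mul_zero,
    Finset.sum_ite_eq', Finset.mem_univ, if_true]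
  ring

theorem torus_conj_signedPerm {w : GSp n F} {σ : Equiv.Perm (Fin n ⊕ Fin n)}
    {s : Fin n ⊕ Fin n → ℤˣ}
    (h : ∀ i j, w.val.val i j = if j = σ i then ((s i : ℤ) : F) else 0) {t t' : Fin n → Fˣ}
    {y : Fˣ} (hσ : ∀ i, (Sum.elim t' fun j => y * (t' j)⁻¹) (σ i) =
      (Sum.elim t fun j => y * (t j)⁻¹) i) :
    w⁻¹ * torus t y * w = torus t' y := by
  rw [mul_assoc, inv_mul_eq_iff_eq_mul]
  refine Subtype.ext (Units.ext ?_)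
  rw [Subgroup.coe_mul, Subgroup.coe_mul, Units.val_mul, Units.val_mul, torus_val_val,
    torus_val_val]
  have hc : ∀ (t : Fin n → Fˣ) (i : Fin n ⊕ Fin n),
      (Sum.elim (fun j => (t j : F)) fun j => (y * (t j)⁻¹ : F)) i =
      ((Sum.elim t fun j => y * (t j)⁻¹) i : Fˣ) := fun t i => by
    rcases i with i | i <;> simp
  ext i j
  rw [Matrix.diagonal_mul, Matrix.mul_diagonal, hc, hc, h]
  split_ifs with hij
  · rw [hij, hσ, mul_comm]
  · simp

theorem J_ne_zero {i j : Fin n ⊕ Fin n} (h : J n F i j ≠ 0) :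
    (∃ a, i = Sum.inl a ∧ j = Sum.inr a) ∨ (∃ a, i = Sum.inr a ∧ j = Sum.inl a) := by
  rcases i with a | a <;> rcases j with b | b
  · simp [J] at h
  · by_cases hab : a = b
    · exact Or.inl ⟨a, rfl, by rw [hab]⟩
    · simp [J, hab] at h
  · by_cases hab : a = b
    · exact Or.inr ⟨a, rfl, by rw [hab]⟩
    · simp [J, hab] at h
  · simp [J] at h

/-- Preserving `J` forces the permutation to preserve the pairs `{e_a, e_a^*}`, possibly swapping
the two members. The signs cancel in the conjugation of a diagonal matrix. -/
theorem IsWeyl.exists_weylAct {w : GSp n F} (hw : IsWeyl w) :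
    ∃ (π : Equiv.Perm (Fin n)) (e : Fin n → Prop), ∀ t y,
      w⁻¹ * torus t y * w = torus (weylAct π e t y) y := by
  obtain ⟨hsp, σ, s, h⟩ := hw
  have hpair : ∀ a : Fin n, ∃ j, (σ (Sum.inl a) = Sum.inl j ∧ σ (Sum.inr a) = Sum.inr j) ∨
      (σ (Sum.inl a) = Sum.inr j ∧ σ (Sum.inr a) = Sum.inl j) := fun a => by
    have h1 := signedPerm_mul_J_mul_transpose h (Sum.inl a) (Sum.inr a)
    rw [hsp, J_inl_inr] at h1
    have h2 : J n F (σ (Sum.inl a)) (σ (Sum.inr a)) ≠ 0 := by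
      intro h0
      simp [h0] at h1
    rcases J_ne_zero h2 with ⟨j, hj⟩ | ⟨j, hj⟩
    · exact ⟨j, Or.inl hj⟩
    · exact ⟨j, Or.inr hj⟩
  choose ρ hρ using hpair
  have hinj : Function.Injective ρ := fun a b hab => by
    have ha := hρ a
    have hb := hρ b
    rw [hab] at ha
    rcases ha with ⟨h1, h2⟩ | ⟨h1, h2⟩ <;> rcases hb with ⟨h3, h4⟩ | ⟨h3, h4⟩
    · exact Sum.inl_injective (σ.injective (h1.trans h3.symm))
    · exact absurd (σ.injective (h1.trans h4.symm)) (by simp)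
    · exact absurd (σ.injective (h1.trans h4.symm)) (by simp)
    · exact Sum.inl_injective (σ.injective (h1.trans h3.symm))
  let π : Equiv.Perm (Fin n) := (Equiv.ofBijective ρ (Finite.injective_iff_bijective.1 hinj)).symm
  have hπ : ∀ a, π (ρ a) = a := fun a => Equiv.ofBijective_symm_apply_apply ρ _ a
  refine ⟨π, fun j => σ (Sum.inl (π j)) = Sum.inr j, fun t y =>
    torus_conj_signedPerm h fun i => ?_⟩
  rcases i with a | a <;> rcases hρ a with ⟨h1, h2⟩ | ⟨h1, h2⟩
  · simp [h1, weylAct, hπ]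
  · simp [h1, weylAct, hπ]
  · simp [h1, h2, weylAct, hπ]
  · simp [h1, h2, weylAct, hπ]

/-- Exchange `e_j` and `e_j^*` for the indices `j` in `e`. -/
def flipPerm (e : Fin n → Prop) : Equiv.Perm (Fin n ⊕ Fin n) :=
  Function.Involutive.toPerm
    (Sum.elim (fun j => if e j then Sum.inr j else Sum.inl j)
      fun j => if e j then Sum.inl j else Sum.inr j)
    (by rintro (j | j) <;> by_cases h : e j <;> simp [h])

theorem exists_isWeyl_weylAct (F : Type*) [Field F] (π : Equiv.Perm (Fin n)) (e : Fin n → Prop) :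
    ∃ w : GSp n F, IsWeyl w ∧ ∀ t y, w⁻¹ * torus t y * w = torus (weylAct π e t y) y := by
  let σ : Equiv.Perm (Fin n ⊕ Fin n) := (Equiv.sumCongr π.symm π.symm).trans (flipPerm e)
  have hl : ∀ a, σ (Sum.inl a) = if e (π.symm a) then Sum.inr (π.symm a) else Sum.inl (π.symm a) :=
    fun a => rfl
  have hr : ∀ a, σ (Sum.inr a) = if e (π.symm a) then Sum.inl (π.symm a) else Sum.inr (π.symm a) :=
    fun a => rfl
  -- One sign for each exchanged pair compensates the antisymmetry of `J`.
  let s : Fin n ⊕ Fin n → ℤˣ := Sum.elim (fun a => if e (π.symm a) then -1 else 1) fun _ => 1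
  let M : Matrix (Fin n ⊕ Fin n) (Fin n ⊕ Fin n) F :=
    Matrix.of fun i j => if j = σ i then ((s i : ℤ) : F) else 0
  have hMs : ∀ i j, M i j = if j = σ i then ((s i : ℤ) : F) else 0 := fun _ _ => rfl
  have hM : M * J n F * Mᵀ = J n F := by
    ext i i'
    rw [signedPerm_mul_J_mul_transpose hMs]
    rcases i with a | a <;> rcases i' with b | b <;> rw [J] <;> simp only [hl, hr, s] <;>
      by_cases ha : e (π.symm a) <;> by_cases hb : e (π.symm b) <;>
      simp [ha, hb, Matrix.one_apply] <;> grind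
  have hJ : J n F * J n F = -1 := by
    rw [J, Matrix.fromBlocks_multiply, ← Matrix.fromBlocks_one, Matrix.fromBlocks_neg]
    simp
  have hinv : M * -(J n F * Mᵀ * J n F) = 1 := by
    rw [mul_neg, ← mul_assoc, ← mul_assoc, hM, hJ, neg_neg]
  let g : GL (Fin n ⊕ Fin n) F := ⟨M, _, hinv, mul_eq_one_comm.1 hinv⟩
  refine ⟨⟨g, 1, by rw [Units.val_one, one_smul]; exact hM⟩, ⟨hM, σ, s, fun _ _ => rfl⟩,
    fun t y => torus_conj_signedPerm (σ := σ) (s := s) (fun _ _ => rfl) fun i => ?_⟩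
  rcases i with a | a <;> by_cases ha : e (π.symm a) <;> simp [hl, hr, ha, weylAct]

theorem weylAct_mul (π : Equiv.Perm (Fin n)) (e : Fin n → Prop) (t t' : Fin n → Fˣ) (y y' : Fˣ) :
    weylAct π e (t * t') (y * y') = weylAct π e t y * weylAct π e t' y' := by
  ext j
  by_cases h : e j
  · simp [weylAct, h]; ring
  · simp [weylAct, h]

theorem weylAct_const (π : Equiv.Perm (Fin n)) (e : Fin n → Prop) (a : Fˣ) :
    weylAct π e (fun _ => a) (a ^ 2) = fun _ => a := by
  ext j
  by_cases h : e j
  · simp [weylAct, h, sq]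
  · simp [weylAct, h]

/-- An inverted entry becomes `s² x⁻¹ = x (s x⁻¹)²`. Squareness of the similitude factor is
essential here. -/
theorem exists_prod_weylAct (π : Equiv.Perm (Fin n)) (e : Fin n → Prop) (t : Fin n → Fˣ) (s : Fˣ) :
    ∃ r, ∏ j, weylAct π e t (s ^ 2) j = (∏ j, t j) * r ^ 2 := by
  refine ⟨∏ j, if e j then s * (t (π j))⁻¹ else 1, ?_⟩
  rw [← Equiv.prod_comp π t, ← Finset.prod_pow, ← Finset.prod_mul_distrib]
  refine Finset.prod_congr rfl fun j _ => ?_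
  by_cases h : e j
  · simp only [weylAct, h, if_true]
    rw [mul_pow, inv_pow, sq (t (π j)), mul_inv, mul_left_comm, mul_inv_cancel_left]
  · simp [weylAct, h]

end Weyl

/-! ### The cover over the torus -/

section TorusCover

variable {n : ℕ} {F : Type*} [Field F]

theorem liftSign_torus (c : Fˣ) (t : Fin n → Fˣ) :
    liftSign c (torus t 1).val = hilbert (∏ i, t i) c := by
  obtain ⟨s, hs⟩ := exists_raoX_torus (F := F) t
  rw [liftSign, cell_torus, hs, hilbert_mul_sq_left]
  simp

theorem liftSign_sq (s : Fˣ) (g : GL (Fin n ⊕ Fin n) F) : liftSign (s ^ 2) g = 1 := by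
  rw [liftSign, hilbert_sq_left, one_pow, mul_one, ← pow_mul, mul_comm, pow_mul, hilbert_sq_right]

theorem cocycle_torus (hn : 1 ≤ n) (t t' : Fin n → Fˣ) (y y' : Fˣ) :
    cocycle (torus t y) (torus t' y') =
      hilbert (∏ i, t i) y' * hilbert (∏ i, t i) (∏ i, t' i) := by
  obtain ⟨s, hs⟩ := exists_raoX_torus (F := F) t'
  rw [cocycle, sim_torus hn, spPart_torus hn, spPart_torus hn, liftSign_torus, iSim, torus_inv,
    torus_mul, torus_mul]
  simp only [inv_one, one_mul, mul_one, inv_mul_cancel]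
  rw [rao_torus_left, hs, hilbert_mul_sq_right]

theorem Mp.mul_def (x y : Mp n F) : x * y = ⟨x.g * y.g, x.ε * y.ε * cocycle x.g y.g⟩ := rfl

theorem Mp.torus_mul (hn : 1 ≤ n) (t t' : Fin n → Fˣ) (y y' : Fˣ) (ε ε' : ℤˣ) :
    (⟨torus t y, ε⟩ * ⟨torus t' y', ε'⟩ : Mp n F) = ⟨torus (t * t') (y * y'),
      ε * ε' * (hilbert (∏ i, t i) y' * hilbert (∏ i, t i) (∏ i, t' i))⟩ := by
  rw [Mp.mul_def, cocycle_torus hn, Metaplectic.torus_mul]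

theorem conj_iSim (hn : 1 ≤ n) (c : Fˣ) (t : Fin n → Fˣ) (y : Fˣ) (ε : ℤˣ) :
    conj ⟨iSim c, 1⟩ ⟨torus t y, ε⟩ = ⟨torus t y, ε * hilbert (∏ i, t i) c⟩ := by
  have h : (iSim c)⁻¹ * torus t y * iSim c = torus t y := by
    rw [iSim, torus_inv, torus_mul, torus_mul]
    simp
  unfold conj
  simp only [h]
  rw [iSim, cocycle_torus hn, cocycle_torus hn]
  simp [hilbert_one_right, hilbert_one_left]

theorem torus_const_comm (a : Fˣ) (g : GSp n F) :
    torus (fun _ => a) (a ^ 2) * g = g * torus (fun _ => a) (a ^ 2) := by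
  refine Subtype.ext (Units.ext ?_)
  have h : (torus (fun _ => a) (a ^ 2) : GSp n F).val.val = Matrix.diagonal fun _ => (a : F) := by
    rw [torus_val_val]
    congr 1
    ext i
    rcases i with i | i <;> simp [sq]
  rw [Subgroup.coe_mul, Subgroup.coe_mul, Units.val_mul, Units.val_mul, h]
  ext i j
  rw [Matrix.diagonal_mul, Matrix.mul_diagonal, mul_comm]

/-- `i(s²)` is the scalar `s` times an element of the torus of `Sp`, and scalars are central. -/
theorem iSim_sq_conj (s : Fˣ) (g : GSp n F) : (iSim (s ^ 2))⁻¹ * g * iSim (s ^ 2) =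
    torus (fun _ => s) 1 * g * torus (fun _ => s⁻¹) 1 := by
  have h : (iSim (s ^ 2) : GSp n F) = torus (fun _ => s⁻¹) 1 * torus (fun _ => s) (s ^ 2) := by
    rw [torus_mul, iSim, one_mul]
    congr 1
    ext i
    simp
  have hc := torus_const_comm s (n := n)
  have hi : (torus (fun _ => s) 1 : GSp n F) = (torus (fun _ => s⁻¹) 1)⁻¹ := by
    rw [torus_inv, inv_one]
    exact congrArg (torus · 1) (funext fun i => (inv_inv s).symm)
  rw [h, hi, mul_inv_rev]
  generalize torus (fun _ : Fin n => s) (s ^ 2) = z at *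
  generalize (torus (fun _ : Fin n => s⁻¹) 1) = x at *
  calc z⁻¹ * x⁻¹ * g * (x * z) = z⁻¹ * (x⁻¹ * g * x * z) := by group
    _ = x⁻¹ * g * x := by rw [← hc, inv_mul_cancel_left]

/-- Both cocycles entering the conjugation equal `(det t, x(w))`: the square class of `det t` is
Weyl invariant, and conjugating `w` by `i(s²)` does not change the class of `x(w)`. They cancel. -/
theorem conj_weyl (hn : 1 ≤ n) {w : GSp n F} (hw : IsWeyl w) {π : Equiv.Perm (Fin n)}
    {e : Fin n → Prop} (hact : ∀ t y, w⁻¹ * torus t y * w = torus (weylAct π e t y) y)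
    (t : Fin n → Fˣ) (s : Fˣ) (ε : ℤˣ) :
    conj ⟨w, 1⟩ ⟨torus t (s ^ 2), ε⟩ = ⟨torus (weylAct π e t (s ^ 2)) (s ^ 2), ε⟩ := by
  unfold conj
  simp only [hact]
  have h1 : cocycle (torus t (s ^ 2)) w = hilbert (∏ i, t i) (raoX w.val) := by
    rw [cocycle, hw.sim_eq_one hn, spPart_torus hn, hw.spPart_eq hn, liftSign_torus,
      hilbert_one_right, iSim, torus_one, inv_one, one_mul, mul_one, one_mul, rao_torus_left]
  have h2 : cocycle w (torus (weylAct π e t (s ^ 2)) (s ^ 2)) =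
      hilbert (∏ i, t i) (raoX w.val) := by
    obtain ⟨r, hr⟩ := exists_prod_weylAct π e t s
    rw [cocycle, sim_torus hn, spPart_torus hn, hw.spPart_eq hn, liftSign_sq, one_mul,
      rao_torus_right, hr, hilbert_mul_sq_right, iSim_sq_conj, hilbert_comm]
    rcases raoX_torus_mul_mul w.val (fun _ => s) (fun _ => s⁻¹) with ⟨v, hv⟩ | ⟨h3, h4⟩
    · rw [Subgroup.coe_mul, Subgroup.coe_mul, hv]
      simp [hilbert_mul_sq_right]
    · rw [Subgroup.coe_mul, Subgroup.coe_mul, h4, h3]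
  rw [h1, h2, mul_assoc, Int.units_mul_self, mul_one]

end TorusCover

/-! ### Invariance of the Weil factor under squares -/

section Weil

theorem norm_add_le_iff {F : Type*} [NontriviallyNormedField F] [IsUltrametricDist F]
    {x h : F} {r : ℝ} (hh : ‖h‖ ≤ r) : ‖x + h‖ ≤ r ↔ ‖x‖ ≤ r := by
  refine ⟨fun hx => ?_, fun hx => norm_add_le_of_le hx hh⟩
  have := norm_add_le_of_le hx (norm_neg h ▸ hh)
  simpa using this

theorem setIntegral_add_right_eq_self {F : Type*} [NontriviallyNormedField F]
    [MeasurableSpace F] [BorelSpace F] (μ : Measure F) [μ.IsAddHaarMeasure] {S : Set F}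
    {h : F} (hS : ∀ x, x + h ∈ S ↔ x ∈ S) (f : F → ℂ) : ∫ x in S, f (x + h) ∂μ = ∫ x in S, f x ∂μ := by
  have h1 := (measurePreserving_add_right μ h).setIntegral_preimage_emb
    (MeasurableEquiv.addRight h).measurableEmbedding f S
  rwa [show (fun x => x + h) ⁻¹' S = S from Set.ext hS] at h1

/-- Translation by `h₀` preserves the ball and multiplies the integral by `ψ(c h₀) ≠ 1`. -/
theorem setIntegral_addChar_mul_eq_zero {F : Type*} [NontriviallyNormedField F]
    [IsUltrametricDist F] [MeasurableSpace F] [BorelSpace F] (μ : Measure F) [μ.IsAddHaarMeasure]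
    (ψ : AddChar F Circle) {ρ : ℝ} {c h₀ : F} (hh₀ : ‖h₀‖ ≤ ρ) (hψ : ψ (c * h₀) ≠ 1) :
    ∫ h in Metric.closedBall (0 : F) ρ, (ψ (c * h) : ℂ) ∂μ = 0 := by
  have h1 := setIntegral_add_right_eq_self μ (S := Metric.closedBall (0 : F) ρ) (h := h₀)
    (fun x => by simpa using norm_add_le_iff hh₀) fun h => (ψ (c * h) : ℂ)
  simp only [mul_add, AddChar.map_add_eq_mul, Circle.coe_mul] at h1
  rw [integral_mul_const] at h1
  have h2 : (ψ (c * h₀) : ℂ) - 1 ≠ 0 := sub_ne_zero.2 fun h => hψ (Circle.ext (by simpa using h))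
  refine (mul_eq_zero.1 ?_).resolve_right h2
  rw [mul_sub, h1, mul_one, sub_self]

variable {F : Type*} [NontriviallyNormedField F] [IsUltrametricDist F] [ProperSpace F]

section Measure

variable [MeasurableSpace F] [BorelSpace F]

theorem exists_setIntegral_annulus_eq_zero [CharZero F] (μ : Measure F) [μ.IsAddHaarMeasure]
    {ψ : AddChar F Circle} (hc : Continuous ψ) (htriv : ∀ x : F, ‖x‖ ≤ 1 → ψ x = 1) {y₀ : F}
    (hy₀ : ψ y₀ ≠ 1) (a : Fˣ) :
    ∃ r₀ : ℝ, ∀ r, ∫ x in Metric.closedBall (0 : F) r \ Metric.closedBall 0 r₀,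
      (ψ (a * x ^ 2) : ℂ) ∂μ = 0 := by
  have ha : 0 < ‖(a : F)‖ := norm_pos_iff.2 a.ne_zero
  have h2a : 0 < ‖2 * (a : F)‖ := norm_pos_iff.2 (mul_ne_zero two_ne_zero a.ne_zero)
  -- For `‖h‖ ≤ ρ` the term `a h²` is integral, so `ψ(a (x + h)²) = ψ(a x²) ψ(2 a x h)`.
  obtain ⟨ρ, hρ0, hρ⟩ : ∃ ρ : ℝ, 0 < ρ ∧ ‖(a : F)‖ * ρ ^ 2 ≤ 1 := by
    refine ⟨min 1 ‖(a : F)‖⁻¹, lt_min one_pos (inv_pos.2 ha), ?_⟩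
    have h0 : 0 ≤ min 1 ‖(a : F)‖⁻¹ := (lt_min one_pos (inv_pos.2 ha)).le
    calc ‖(a : F)‖ * min 1 ‖(a : F)‖⁻¹ ^ 2
        = ‖(a : F)‖ * (min 1 ‖(a : F)‖⁻¹ * min 1 ‖(a : F)‖⁻¹) := by rw [sq]
      _ ≤ ‖(a : F)‖ * (1 * ‖(a : F)‖⁻¹) := by
        gcongr
        · exact min_le_left _ _
        · exact min_le_right _ _
      _ = 1 := by rw [one_mul, mul_inv_cancel₀ ha.ne']
  -- For `‖x‖ > r₀` the point `y₀ / (2 a x)` lies in the ball of radius `ρ`, so `h ↦ ψ(2 a x h)` is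
  -- nontrivial there. The bound by `ρ` makes the annulus stable under translation by that ball.
  set r₀ := max ρ (‖y₀‖ / (‖2 * (a : F)‖ * ρ)) with hr₀
  refine ⟨r₀, fun r => ?_⟩
  set A := Metric.closedBall (0 : F) r \ Metric.closedBall 0 r₀ with hA
  set H := Metric.closedBall (0 : F) ρ with hH
  have hAm : MeasurableSet A := Metric.isClosed_closedBall.measurableSet.diff
    Metric.isClosed_closedBall.measurableSet
  have hHm : MeasurableSet H := Metric.isClosed_closedBall.measurableSet
  have hAfin : μ A ≠ ⊤ := ne_top_of_le_ne_top (isCompact_closedBall (0 : F) r).measure_ne_top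
    (measure_mono Set.sdiff_subset)
  have hHfin : μ H ≠ ⊤ := (isCompact_closedBall (0 : F) ρ).measure_ne_top
  have : IsFiniteMeasure (μ.restrict A) := isFiniteMeasure_restrict.2 hAfin
  have : IsFiniteMeasure (μ.restrict H) := isFiniteMeasure_restrict.2 hHfin
  have hshift : ∀ h ∈ H, ∫ x in A, (ψ (a * (x + h) ^ 2) : ℂ) ∂μ =
      ∫ x in A, (ψ (a * x ^ 2) : ℂ) ∂μ := fun h hh => by
    have hh' : ‖h‖ ≤ ρ := by simpa [hH] using hh
    refine setIntegral_add_right_eq_self μ (fun x => ?_) fun x => (ψ (a * x ^ 2) : ℂ)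
    have e1 := norm_add_le_iff (x := x) (hh'.trans (le_max_left _ _ : ρ ≤ r₀))
    rw [hA, Set.mem_sdiff, Set.mem_sdiff]
    simp only [Metric.mem_closedBall, dist_zero_right]
    rw [e1]
    refine and_congr_left fun hx => ?_
    have hxr : ‖h‖ < ‖x‖ := (hh'.trans (le_max_left _ _)).trans_lt (not_le.1 hx)
    rw [norm_add_eq_left hxr]
  -- Integrating over `x` first gives the measure of `H` times the desired integral; integrating
  -- over `h` first gives zero.
  have hswap := integral_integral_swap (μ := μ.restrict H) (ν := μ.restrict A)
    (f := fun h x => (ψ (a * (x + h) ^ 2) : ℂ)) (Integrable.of_bound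
      (Continuous.aestronglyMeasurable (by fun_prop)) 1 (ae_of_all _ fun z => (Circle.norm_coe _).le))
  have hinner : ∀ x ∈ A, ∫ h in H, (ψ (a * (x + h) ^ 2) : ℂ) ∂μ = 0 := fun x hx => by
    have hx' : r₀ < ‖x‖ := by simpa using hx.2
    have hx0 : 0 < ‖x‖ := (hρ0.trans_le (le_max_left _ _)).trans hx'
    have hxne : x ≠ 0 := norm_pos_iff.1 hx0
    have h2 : (2 * (a : F)) ≠ 0 := norm_pos_iff.1 h2a
    have hz := setIntegral_addChar_mul_eq_zero μ ψ (ρ := ρ) (c := 2 * a * x)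
      (h₀ := y₀ / (2 * a * x)) (by
        rw [norm_div, norm_mul, div_le_iff₀ (mul_pos h2a hx0)]
        have := (le_max_right ρ _).trans hx'.le
        rw [div_le_iff₀ (mul_pos h2a hρ0)] at this
        linarith) (by rwa [mul_div_cancel₀ _ (mul_ne_zero h2 hxne)])
    rw [setIntegral_congr_fun (g := fun h => (ψ (a * x ^ 2) : ℂ) * (ψ (2 * a * x * h) : ℂ)) hHm,
      integral_const_mul, hz, mul_zero]
    intro h hh
    have hh' : ‖h‖ ≤ ρ := by simpa [hH] using hh
    have h1 : ψ (a * h ^ 2) = 1 := htriv _ (by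
      rw [norm_mul, norm_pow]
      refine le_trans ?_ hρ
      gcongr)
    change (ψ (a * (x + h) ^ 2) : ℂ) = _
    rw [show (a : F) * (x + h) ^ 2 = a * x ^ 2 + 2 * a * x * h + a * h ^ 2 by ring,
      AddChar.map_add_eq_mul, AddChar.map_add_eq_mul, h1, mul_one, Circle.coe_mul]
  rw [setIntegral_congr_fun hHm hshift, setIntegral_congr_fun hAm hinner, integral_zero,
    setIntegral_const] at hswap
  refine (smul_eq_zero.1 hswap).resolve_left ?_
  refine ENNReal.toReal_ne_zero.2 ⟨(Metric.measure_closedBall_pos μ 0 hρ0).ne', hHfin⟩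

theorem exists_setIntegral_closedBall_eq [CharZero F] (μ : Measure F) [μ.IsAddHaarMeasure]
    {ψ : AddChar F Circle} (hc : Continuous ψ) (htriv : ∀ x : F, ‖x‖ ≤ 1 → ψ x = 1) {y₀ : F}
    (hy₀ : ψ y₀ ≠ 1) (a : Fˣ) :
    ∃ (r₀ : ℝ) (c : ℂ), ∀ r, r₀ ≤ r →
      ∫ x in Metric.closedBall (0 : F) r, (ψ (a * x ^ 2) : ℂ) ∂μ = c := by
  obtain ⟨r₀, h⟩ := exists_setIntegral_annulus_eq_zero μ hc htriv hy₀ a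
  refine ⟨r₀, ∫ x in Metric.closedBall (0 : F) r₀, (ψ (a * x ^ 2) : ℂ) ∂μ, fun r hr => ?_⟩
  have hint : IntegrableOn (fun x : F => (ψ (a * x ^ 2) : ℂ)) (Metric.closedBall (0 : F) r) μ :=
    ContinuousOn.integrableOn_compact (isCompact_closedBall (0 : F) r)
      (Continuous.continuousOn (by fun_prop))
  have := setIntegral_sdiff (Metric.isClosed_closedBall.measurableSet) hint
    (Metric.closedBall_subset_closedBall hr)
  rw [h r] at this
  exact (sub_eq_zero.1 this.symm)

/-- Only the positivity of the factor `k` matters: it cancels in the phase. -/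
theorem exists_setIntegral_comp_mul_left (μ : Measure F) [μ.IsAddHaarMeasure] (b : Fˣ) :
    ∃ k : ℝ, 0 < k ∧ ∀ (f : F → ℂ) (r : ℝ), ∫ x in Metric.closedBall (0 : F) r, f (b * x) ∂μ =
      k * ∫ x in Metric.closedBall (0 : F) (‖(b : F)‖ * r), f x ∂μ := by
  let e : F ≃ₜ F := Homeomorph.mulLeft₀ (b : F) b.ne_zero
  let e' : F ≃+ F := { e.toEquiv with map_add' := fun x y => mul_add _ x y }
  have hH : (Measure.map e' μ).IsAddHaarMeasure := e'.isAddHaarMeasure_map μ e.continuous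
    e.symm.continuous
  have heq := Measure.isAddLeftInvariant_eq_smul (Measure.map e' μ) μ
  have hpos := Measure.addHaarScalarFactor_pos_of_isAddHaarMeasure (Measure.map e' μ) μ
  refine ⟨(Measure.map e' μ).addHaarScalarFactor μ, hpos, fun f r => ?_⟩
  have hpre : (e' : F → F) ⁻¹' Metric.closedBall (0 : F) (‖(b : F)‖ * r) =
      Metric.closedBall (0 : F) r := by
    ext x
    have : 0 < ‖(b : F)‖ := norm_pos_iff.2 b.ne_zero
    change (b : F) * x ∈ Metric.closedBall (0 : F) (‖(b : F)‖ * r) ↔ x ∈ Metric.closedBall (0 : F) r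
    simp [this]
  have h1 := e.measurableEmbedding.setIntegral_map (μ := μ) f
    (Metric.closedBall (0 : F) (‖(b : F)‖ * r))
  change ∫ y in _, f y ∂(Measure.map e' μ) = ∫ x in e' ⁻¹' _, f (b * x) ∂μ at h1
  rw [hpre, heq, Measure.restrict_smul, integral_smul_nnreal_measure] at h1
  rw [← h1, NNReal.smul_def, Complex.real_smul]

end Measure

theorem tendsto_phase_gaussIntegral [CharZero F] {ϖ : Fˣ} {ψ : AddChar F Circle}
    (hψ : IsNormalized ϖ ψ) (a b : Fˣ) : ∃ c : ℂ,
    Tendsto (fun m : ℕ => gaussIntegral ψ a m / (‖gaussIntegral ψ a m‖ : ℂ)) atTop (𝓝 c) ∧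
    Tendsto (fun m : ℕ => gaussIntegral ψ (a * b ^ 2) m / (‖gaussIntegral ψ (a * b ^ 2) m‖ : ℂ))
      atTop (𝓝 c) := by
  let : MeasurableSpace F := borel F
  have : BorelSpace F := ⟨rfl⟩
  obtain ⟨hc, htriv, y₀, -, hy₀⟩ := hψ
  obtain ⟨r₀, c, h⟩ := exists_setIntegral_closedBall_eq Measure.addHaar hc htriv hy₀ a
  obtain ⟨k, hk, hb⟩ := exists_setIntegral_comp_mul_left (Measure.addHaar : Measure F) b
  have hb0 : 0 < ‖(b : F)‖ := norm_pos_iff.2 b.ne_zero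
  refine ⟨c / ‖c‖, tendsto_const_nhds.congr' ?_, tendsto_const_nhds.congr' ?_⟩
  · filter_upwards [eventually_ge_atTop ⌈r₀⌉₊] with m hm
    have h1 : gaussIntegral ψ a m = c := h m ((Nat.le_ceil r₀).trans (by exact_mod_cast hm))
    rw [h1]
  · filter_upwards [eventually_ge_atTop ⌈r₀ / ‖(b : F)‖⌉₊] with m hm
    have h1 : gaussIntegral ψ (a * b ^ 2) m = k * c := by
      have h2 : r₀ / ‖(b : F)‖ ≤ m := (Nat.le_ceil _).trans (by exact_mod_cast hm)
      rw [div_le_iff₀ hb0, mul_comm] at h2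
      have h3 := hb (fun x => (ψ (a * x ^ 2) : ℂ)) m
      rw [h _ h2] at h3
      rw [← h3]
      unfold gaussIntegral
      congr 1
      ext x
      congr 2
      push_cast
      ring
    rw [h1, norm_mul, Complex.norm_real, Real.norm_of_nonneg hk.le, Complex.ofReal_mul,
      mul_div_mul_left _ _ (by exact_mod_cast hk.ne')]

theorem weilFactor_mul_sq [CharZero F] {ϖ : Fˣ} {ψ : AddChar F Circle}
    (hψ : IsNormalized ϖ ψ) (a b : Fˣ) : weilFactor ψ (a * b ^ 2) = weilFactor ψ a := by
  obtain ⟨c, h1, h2⟩ := tendsto_phase_gaussIntegral hψ a b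
  unfold weilFactor weilIndex
  rw [h1.limUnder_eq, h2.limUnder_eq]

end Weil

/-! ### Pairings of parameters -/

section Pairing

/-- Opposite pairs are removed one at a time. A nonzero value has its negative at a different index;
if all values vanish, any two indices form a pair. -/
theorem exists_pairing {ι : Type*} (f : ι → ℂ) (m : ℕ) (S : Finset ι) (hS : S.card = 2 * m)
    (hf : (S.val.map f).map Neg.neg = S.val.map f) :
    ∃ P Q : Fin m → ι, Function.Injective (Sum.elim P Q) ∧ (∀ j, P j ∈ S ∧ Q j ∈ S) ∧
      ∀ j, f (Q j) = -f (P j) := by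
  induction m generalizing S with
  | zero => exact ⟨Fin.elim0, Fin.elim0, by rintro (⟨j, hj⟩ | ⟨j, hj⟩) <;> omega,
      fun j => j.elim0, fun j => j.elim0⟩
  | succ m ih =>
    obtain ⟨x, hx, y, hy, hxy, hfxy⟩ : ∃ x ∈ S, ∃ y ∈ S, y ≠ x ∧ f y = -f x := by
      by_cases h : ∃ x ∈ S, f x ≠ 0
      · obtain ⟨x, hx, hx0⟩ := h
        have h1 : -f x ∈ S.val.map f := by
          rw [← hf, Multiset.map_map]
          exact Multiset.mem_map.2 ⟨x, hx, rfl⟩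
        obtain ⟨y, hy, hfy⟩ := Multiset.mem_map.1 h1
        refine ⟨x, hx, y, hy, ?_, hfy⟩
        rintro rfl
        exact hx0 (self_eq_neg.1 hfy)
      · push Not at h
        obtain ⟨x, hx, y, hy, hxy⟩ := Finset.one_lt_card.1 (by omega : 1 < S.card)
        exact ⟨x, hx, y, hy, hxy.symm, by rw [h x hx, h y hy, neg_zero]⟩
    have hy' : y ∈ S.erase x := Finset.mem_erase.2 ⟨hxy, hy⟩
    set S' := (S.erase x).erase y with hS'
    have hval : S.val.map f = f x ::ₘ -f x ::ₘ S'.val.map f := by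
      conv_lhs => rw [← Finset.insert_erase hx, ← Finset.insert_erase hy']
      rw [Finset.insert_val_of_notMem, Finset.insert_val_of_notMem, Multiset.map_cons,
        Multiset.map_cons, hfxy]
      · simp
      · rw [Finset.insert_erase hy']
        simp
    have hcard : S'.card = 2 * m := by
      rw [hS', Finset.card_erase_of_mem hy', Finset.card_erase_of_mem hx, hS]
      omega
    have hf' : (S'.val.map f).map Neg.neg = S'.val.map f := by
      rw [hval, Multiset.map_cons, Multiset.map_cons, neg_neg, Multiset.cons_swap,
        Multiset.cons_inj_right, Multiset.cons_inj_right] at hf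
      exact hf
    obtain ⟨P, Q, hinj, hmem, hPQ⟩ := ih S' hcard hf'
    have hP : ∀ j, P j ∈ S ∧ P j ≠ x ∧ P j ≠ y := fun j => by
      have := (hmem j).1
      simp only [hS', Finset.mem_erase] at this
      tauto
    have hQ : ∀ j, Q j ∈ S ∧ Q j ≠ x ∧ Q j ≠ y := fun j => by
      have := (hmem j).2
      simp only [hS', Finset.mem_erase] at this
      tauto
    refine ⟨Fin.cons x P, Fin.cons y Q, ?_, fun j => ?_, fun j => ?_⟩
    · have hPi : Function.Injective P := fun i j hij =>
        Sum.inl_injective (hinj (a₁ := Sum.inl i) (a₂ := Sum.inl j) hij)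
      have hQi : Function.Injective Q := fun i j hij =>
        Sum.inr_injective (hinj (a₁ := Sum.inr i) (a₂ := Sum.inr j) hij)
      have hPQi : ∀ i j, P i ≠ Q j := fun i j hij =>
        absurd (hinj (a₁ := Sum.inl i) (a₂ := Sum.inr j) hij) (by simp)
      refine Function.Injective.sumElim ?_ ?_ ?_
      · exact Fin.cons_injective_iff.2 ⟨fun ⟨j, hj⟩ => (hP j).2.1 hj, hPi⟩
      · exact Fin.cons_injective_iff.2 ⟨fun ⟨j, hj⟩ => (hQ j).2.2 hj, hQi⟩
      · intro i j
        refine Fin.cases ?_ (fun i => ?_) i <;> refine Fin.cases ?_ (fun j => ?_) j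
        · simpa using hxy.symm
        · simpa using (hQ j).2.1.symm
        · simpa using (hP i).2.2
        · simpa using hPQi i j
    · refine Fin.cases ?_ (fun j => ?_) j
      · exact ⟨hx, hy⟩
      · exact ⟨(hP j).1, (hQ j).1⟩
    · refine Fin.cases ?_ (fun j => ?_) j
      · exact hfxy
      · exact hPQ j

/-- The trace `x + x⁻¹`, which determines `x` up to inversion. -/
def unitTrace (x : ℂˣ) : ℂ := x + (x⁻¹ : ℂˣ)

theorem unitTrace_neg (x : ℂˣ) : unitTrace (-x) = -unitTrace x := by
  simp [unitTrace]
  ring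

theorem unitTrace_inv (x : ℂˣ) : unitTrace x⁻¹ = unitTrace x := by
  rw [unitTrace, unitTrace, inv_inv, add_comm]

theorem unitTrace_eq_iff {x y : ℂˣ} : unitTrace x = unitTrace y ↔ x = y ∨ x = y⁻¹ := by
  constructor
  · intro h
    unfold unitTrace at h
    have h1 : ((x : ℂ) - y) * (x * y - 1) = 0 := by
      have hx : (x : ℂ) * (x⁻¹ : ℂˣ) = 1 := x.mul_inv
      have hy : (y : ℂ) * (y⁻¹ : ℂˣ) = 1 := y.mul_inv
      linear_combination (x : ℂ) * y * h - (y : ℂ) * hx + x * hy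
    rcases mul_eq_zero.1 h1 with h | h
    · exact Or.inl (Units.ext (sub_eq_zero.1 h))
    · exact Or.inr (eq_inv_of_mul_eq_one_left (Units.ext (by simpa using sub_eq_zero.1 h)))
  · rintro (rfl | rfl)
    · rfl
    · exact unitTrace_inv y

theorem exists_perm_neg_iff_exists_paired {n : ℕ} (hn : Even n) (α : Fin n → ℂˣ) :
    (∃ ρ : Equiv.Perm (Fin n), ∀ i, unitTrace ((-α) i) = unitTrace (α (ρ i))) ↔
      ∃ (a : ℕ → ℂˣ) (ρ : Equiv.Perm (Fin n)),
        ∀ i, unitTrace (pairedAlpha n a i) = unitTrace (α (ρ i)) := by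
  obtain ⟨m, rfl⟩ := hn
  constructor
  · rintro ⟨ρ, hρ⟩
    obtain ⟨P, Q, hinj, -, hPQ⟩ := exists_pairing (fun i => unitTrace (α i)) m Finset.univ
      (by simp; ring) (by
        rw [Multiset.map_map]
        have h1 : (Neg.neg ∘ fun i => unitTrace (α i)) = (fun i => unitTrace (α i)) ∘ ρ :=
          funext fun i => by
            simp only [Function.comp_apply]
            rw [← hρ, Pi.neg_apply, unitTrace_neg]
        rw [h1, ← Multiset.map_map]
        congr 1
        exact Multiset.map_univ_val_equiv ρ)
    have hlt : ∀ i : Fin (m + m), (i : ℕ) / 2 < m := fun i => by omega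
    let τ : Fin (m + m) → Fin (m + m) := fun i =>
      if Even (i : ℕ) then P ⟨i / 2, hlt i⟩ else Q ⟨i / 2, hlt i⟩
    have hτ : Function.Injective τ := by
      intro i j hij
      by_cases hi : Even (i : ℕ) <;> by_cases hj : Even (j : ℕ) <;> simp only [τ, hi, hj] at hij
      · have := Sum.inl_injective (hinj (a₁ := Sum.inl _) (a₂ := Sum.inl _) hij)
        rw [Nat.even_iff] at hi hj
        simp only [Fin.mk.injEq] at this
        omega
      · exact absurd (hinj (a₁ := Sum.inl _) (a₂ := Sum.inr _) hij) (by simp)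
      · exact absurd (hinj (a₁ := Sum.inr _) (a₂ := Sum.inl _) hij) (by simp)
      · have := Sum.inr_injective (hinj (a₁ := Sum.inr _) (a₂ := Sum.inr _) hij)
        rw [Nat.even_iff] at hi hj
        simp only [Fin.mk.injEq] at this
        omega
    -- The value `1` for `j ≥ m` is never read by `pairedAlpha`.
    refine ⟨fun j => if h : j < m then α (P ⟨j, h⟩) else 1,
      Equiv.ofBijective τ (Finite.injective_iff_bijective.1 hτ), fun i => ?_⟩
    rw [Equiv.ofBijective_apply]
    by_cases hi : Even (i : ℕ)
    · simp [pairedAlpha, τ, hi, hlt i]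
    · simp only [pairedAlpha, τ, hi, hlt i, if_false, dif_pos]
      rw [unitTrace_neg]
      exact (hPQ _).symm
  · rintro ⟨a, ρ, hρ⟩
    -- The involution exchanging the positions `2j` and `2j + 1`, which negates `pairedAlpha`.
    let s : Fin (m + m) → Fin (m + m) := fun i =>
      if h : Even (i : ℕ) then ⟨i + 1, by rw [Nat.even_iff] at h; omega⟩ else ⟨i - 1, by omega⟩
    have hs : Function.Involutive s := by
      intro i
      by_cases h : Even (i : ℕ)
      · have h' : ¬ Even ((i : ℕ) + 1) := by rwa [Nat.even_add_one, not_not]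
        simp [s, h, h']
      · have h' : Even ((i : ℕ) - 1) := by
          rw [Nat.even_iff] at h ⊢
          omega
        have h1 : 1 ≤ (i : ℕ) := by
          rw [Nat.even_iff] at h
          omega
        simp [s, h, h', Nat.sub_add_cancel h1]
    have hneg : ∀ i, pairedAlpha (m + m) a (s i) = -pairedAlpha (m + m) a i := by
      intro i
      by_cases h : Even (i : ℕ)
      · have h' : ¬ Even ((i : ℕ) + 1) := by rwa [Nat.even_add_one, not_not]
        have h2 : ((i : ℕ) + 1) / 2 = i / 2 := by
          rw [Nat.even_iff] at h
          omega
        simp [pairedAlpha, s, h, h', h2]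
      · have h' : Even ((i : ℕ) - 1) := by
          rw [Nat.even_iff] at h ⊢
          omega
        have h2 : ((i : ℕ) - 1) / 2 = i / 2 := by
          rw [Nat.even_iff] at h
          omega
        simp [pairedAlpha, s, h, h', h2]
    refine ⟨(ρ.symm.trans hs.toPerm).trans ρ, fun i => ?_⟩
    have h1 := hρ (s (ρ.symm i))
    rw [hneg, unitTrace_neg, hρ, Equiv.apply_symm_apply] at h1
    rw [Pi.neg_apply, unitTrace_neg, h1]
    rfl

end Pairing

/-! ### Unramified characters of the torus -/

section Ord

variable {F : Type*} [NontriviallyNormedField F] {ϖ : Fˣ}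

theorem IsUniformizer.norm_pos (_ : IsUniformizer ϖ) : 0 < ‖(ϖ : F)‖ := norm_pos_iff.2 ϖ.ne_zero

theorem IsUniformizer.ord_eq (h : IsUniformizer ϖ) {a : Fˣ} {k : ℤ}
    (ha : ‖(a : F)‖ = ‖(ϖ : F)‖ ^ k) : ord ϖ a = k := by
  have h0 := h.norm_pos
  rw [ord, ha, ← Real.rpow_intCast, Real.logb_rpow h0 h.1.ne, Int.floor_intCast]

theorem IsUniformizer.norm_eq (h : IsUniformizer ϖ) (a : Fˣ) :
    ‖(a : F)‖ = ‖(ϖ : F)‖ ^ ord ϖ a := by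
  obtain ⟨k, hk⟩ := h.exists_zpow a
  rw [h.ord_eq hk, hk]

theorem IsUniformizer.ord_self (h : IsUniformizer ϖ) : ord ϖ ϖ = 1 := h.ord_eq (by simp)

theorem IsUniformizer.ord_of_norm_eq_one (h : IsUniformizer ϖ) {a : Fˣ} (ha : ‖(a : F)‖ = 1) :
    ord ϖ a = 0 := h.ord_eq (by simpa using ha)

theorem IsUniformizer.ord_mul (h : IsUniformizer ϖ) (a b : Fˣ) :
    ord ϖ (a * b) = ord ϖ a + ord ϖ b :=
  h.ord_eq (by
    rw [Units.val_mul, norm_mul, h.norm_eq a, h.norm_eq b, zpow_add₀ h.norm_pos.ne'])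

theorem IsUniformizer.ord_inv (h : IsUniformizer ϖ) (a : Fˣ) : ord ϖ a⁻¹ = -ord ϖ a :=
  h.ord_eq (by rw [Units.val_inv_eq_inv_val, norm_inv, h.norm_eq a, zpow_neg])

theorem IsUniformizer.ord_prod (h : IsUniformizer ϖ) {ι : Type*} (s : Finset ι) (t : ι → Fˣ) :
    ord ϖ (∏ i ∈ s, t i) = ∑ i ∈ s, ord ϖ (t i) := by
  induction s using Finset.induction_on with
  | empty => simpa using h.ord_of_norm_eq_one (a := 1) (by simp)
  | insert a s ha ih => rw [Finset.prod_insert ha, Finset.sum_insert ha, h.ord_mul, ih]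

theorem IsUniformizer.exists_norm_eq_sq_iff (h : IsUniformizer ϖ) {a : Fˣ} :
    (∃ z : F, ‖(a : F)‖ = ‖z‖ ^ 2) ↔ Even (ord ϖ a) := by
  constructor
  · rintro ⟨z, hz⟩
    have hz0 : z ≠ 0 := by
      rintro rfl
      simp at hz
    refine ⟨ord ϖ (Units.mk0 z hz0), ?_⟩
    rw [← h.ord_mul]
    exact h.ord_eq (by rw [← h.norm_eq, hz]; simp [sq])
  · rintro ⟨k, hk⟩
    refine ⟨(ϖ : F) ^ k, ?_⟩
    rw [h.norm_eq a, hk, zpow_add₀ h.norm_pos.ne', norm_zpow, sq]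

variable {n : ℕ}

theorem chiAlpha_injective (h : IsUniformizer ϖ) {α α' : Fin n → ℂˣ}
    (hχ : ∀ t, chiAlpha ϖ α t = chiAlpha ϖ α' t) : α = α' := by
  ext1 i
  have h1 : ∀ α : Fin n → ℂˣ, chiAlpha ϖ α (Pi.mulSingle (Fin.rev i) ϖ) = α i := fun α => by
    rw [chiAlpha, Finset.prod_eq_single i]
    · rw [Pi.mulSingle_eq_same, h.ord_self, zpow_one]
    · intro j _ hj
      rw [Pi.mulSingle_eq_of_ne (fun hh => hj (Fin.rev_injective hh)),
        h.ord_of_norm_eq_one (by simp), zpow_zero]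
    · simp
  rw [← h1 α, ← h1 α', hχ]

theorem chiAlpha_neg (h : IsUniformizer ϖ) (α : Fin n → ℂˣ) (t : Fin n → Fˣ) :
    chiAlpha ϖ (-α) t = (-1) ^ ord ϖ (∏ i, t i) * chiAlpha ϖ α t := by
  rw [chiAlpha, chiAlpha, h.ord_prod, ← Equiv.sum_comp Fin.revPerm]
  simp only [Fin.revPerm_apply, Pi.neg_apply]
  have hsum : ∀ k : Fin n → ℤ, (-1 : ℂˣ) ^ ∑ i, k i = ∏ i, (-1) ^ k i := fun k => by
    generalize (Finset.univ : Finset (Fin n)) = s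
    induction s using Finset.induction_on with
    | empty => simp
    | insert a s ha ih => rw [Finset.sum_insert ha, Finset.prod_insert ha, zpow_add, ih]
  rw [hsum, ← Finset.prod_mul_distrib]
  refine Finset.prod_congr rfl fun i _ => ?_
  rw [← mul_zpow, neg_one_mul]

/-- The parameters of the Weyl conjugate of `χ_α`. -/
def weylParam (π : Equiv.Perm (Fin n)) (e : Fin n → Prop) (α : Fin n → ℂˣ) : Fin n → ℂˣ :=
  fun i => if e (π.symm (Fin.rev i)) then (α (Fin.rev (π.symm (Fin.rev i))))⁻¹
    else α (Fin.rev (π.symm (Fin.rev i)))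

theorem chiAlpha_weylAct (h : IsUniformizer ϖ) (π : Equiv.Perm (Fin n)) (e : Fin n → Prop)
    (α : Fin n → ℂˣ) (t : Fin n → Fˣ) :
    chiAlpha ϖ α (weylAct π e t 1) = chiAlpha ϖ (weylParam π e α) t := by
  rw [chiAlpha, chiAlpha]
  conv_rhs => rw [← Equiv.prod_comp ((Fin.revPerm.trans π).trans Fin.revPerm)]
  refine Finset.prod_congr rfl fun i _ => ?_
  by_cases hi : e (Fin.rev i)
  · simp [weylAct, weylParam, hi, h.ord_inv]
  · simp [weylAct, weylParam, hi]

/-- The trace determines `{x, x⁻¹}`, so orbits under permutations and inversions correspond to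
multisets of traces. -/
theorem exists_weylParam_iff {α β : Fin n → ℂˣ} :
    (∃ (π : Equiv.Perm (Fin n)) (e : Fin n → Prop), weylParam π e α = β) ↔
      ∃ ρ : Equiv.Perm (Fin n), ∀ i, unitTrace (β i) = unitTrace (α (ρ i)) := by
  constructor
  · rintro ⟨π, e, rfl⟩
    refine ⟨(Fin.revPerm.trans π.symm).trans Fin.revPerm, fun i => ?_⟩
    by_cases hi : e (π.symm (Fin.rev i))
    · simp [weylParam, hi, unitTrace_inv]
    · simp [weylParam, hi]
  · rintro ⟨ρ, hρ⟩
    refine ⟨((Fin.revPerm.trans ρ).trans Fin.revPerm).symm,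
      fun j => ¬ β (ρ.symm (Fin.rev j)) = α (Fin.rev j), ?_⟩
    ext1 i
    by_cases hi : β i = α (ρ i)
    · simp [weylParam, hi]
    · have := (unitTrace_eq_iff.1 (hρ i)).resolve_left hi
      simpa [weylParam, this] using fun hh : (α (ρ i))⁻¹ = α (ρ i) => hh.symm

end Ord

/-! ### Genuine characters of the torus cover -/

section Characters

variable {n : ℕ}

/-- A sign as a nonzero complex number. -/
def signUnit : ℤˣ →* ℂˣ := Units.map (Int.castRingHom ℂ : ℤ →* ℂ)

theorem signUnit_neg_one : signUnit (-1) = -1 := by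
  ext
  simp [signUnit]

theorem signUnit_eq_one_iff {δ : ℤˣ} : signUnit δ = 1 ↔ δ = 1 := by
  refine ⟨fun h => ?_, fun h => by rw [h, map_one]⟩
  rcases Int.units_eq_one_or δ with rfl | rfl
  · rfl
  · rw [signUnit_neg_one, Units.ext_iff] at h
    norm_num at h

/-- The element `([t, s²], ε)` of `T̃'⁺`. -/
def plusElt {F : Type*} [Field F] (t : Fin n → Fˣ) (s : Fˣ) (ε : ℤˣ) : TPlus n F :=
  ⟨⟨torus t (s ^ 2), ε⟩, t, s, rfl⟩

theorem exists_eq_plusElt {F : Type*} [Field F] (x : TPlus n F) : ∃ t s ε, x = plusElt t s ε := by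
  obtain ⟨⟨g, ε⟩, t, s, h⟩ := x
  exact ⟨t, s, ε, Subtype.ext (Mp.ext h rfl)⟩

theorem mem_ZT {F : Type*} [Field F] (hn : 1 ≤ n) {t : Fin n → Fˣ} {s r : Fˣ} {ε : ℤˣ}
    (ht : ∏ i, t i = r ^ 2) : (⟨torus t (s ^ 2), ε⟩ : Mp n F) ∈ ZT n F := by
  refine ⟨⟨t, _, rfl⟩, ?_⟩
  rintro ⟨g, ε'⟩ ⟨t', y', rfl : g = torus t' y'⟩
  rw [Mp.torus_mul hn, Mp.torus_mul hn, ht]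
  simp only [hilbert_sq_left, hilbert_sq_right, mul_comm]

/-- The central element over `[t, s²]` when `det t` is a square. -/
def centralElt {F : Type*} [Field F] (hn : 1 ≤ n) (t : Fin n → Fˣ) (s : Fˣ) (ε : ℤˣ)
    (ht : ∃ r, ∏ i, t i = r ^ 2) : ZT n F :=
  ⟨⟨torus t (s ^ 2), ε⟩, mem_ZT hn ht.choose_spec⟩

variable {F : Type*} [NontriviallyNormedField F]

theorem GenuineChar.map_sign_mul (hn : 1 ≤ n) (φ : GenuineChar (TPlus n F)) (t : Fin n → Fˣ)
    (s : Fˣ) (ε δ : ℤˣ) :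
    φ.toFun (plusElt t s (ε * δ)) = signUnit δ * φ.toFun (plusElt t s ε) := by
  rcases Int.units_eq_one_or δ with rfl | rfl
  · rw [map_one, one_mul, mul_one]
  · rw [signUnit_neg_one, ← φ.genuine (plusElt 1 1 (-1)) (by
      change (⟨torus 1 (1 ^ 2), -1⟩ : Mp n F) = _
      rw [one_pow, torus_one])]
    refine φ.map_mul _ _ _ ?_
    change (⟨torus 1 (1 ^ 2), -1⟩ * ⟨torus t (s ^ 2), ε⟩ : Mp n F) = ⟨torus t (s ^ 2), ε * -1⟩
    rw [Mp.torus_mul hn]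
    simp [hilbert_one_left]

theorem GenuineChar.map_central_mul (hn : 1 ≤ n) {ω : GenuineChar (ZT n F)}
    {φ : GenuineChar (TPlus n F)} (hφ : φ ∈ E ω) {t t' : Fin n → Fˣ} (s s' : Fˣ) (ε ε' : ℤˣ)
    (ht : ∃ r, ∏ i, t i = r ^ 2) :
    φ.toFun (plusElt (t * t') (s * s') (ε * ε')) =
      ω.toFun (centralElt hn t s ε ht) * φ.toFun (plusElt t' s' ε') := by
  rw [← hφ (centralElt hn t s ε ht) (plusElt t s ε) rfl]
  refine φ.map_mul _ _ _ ?_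
  change (⟨torus t (s ^ 2), ε⟩ * ⟨torus t' (s' ^ 2), ε'⟩ : Mp n F) =
    ⟨torus (t * t') ((s * s') ^ 2), ε * ε'⟩
  obtain ⟨r, hr⟩ := ht
  rw [Mp.torus_mul hn, hr, hilbert_sq_left, hilbert_sq_left, mul_one, mul_one, mul_pow]

theorem twist_iSim_plusElt (hn : 1 ≤ n) (φ : GenuineChar (TPlus n F)) (c : Fˣ) (t : Fin n → Fˣ)
    (s : Fˣ) (ε : ℤˣ) : twist ⟨iSim c, 1⟩ φ.toFun (plusElt t s ε) =
      signUnit (hilbert (∏ i, t i) c) * φ.toFun (plusElt t s ε) := by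
  have h : conj ⟨iSim c, 1⟩ (plusElt t s ε : Mp n F) = plusElt t s (ε * hilbert (∏ i, t i) c) :=
    conj_iSim hn c t (s ^ 2) ε
  rw [← φ.map_sign_mul hn, twist, dif_pos (by rw [h]; exact Subtype.coe_prop _)]
  congr 1
  exact Subtype.ext h

theorem twist_weyl_plusElt (hn : 1 ≤ n) (φ : GenuineChar (TPlus n F)) {w : GSp n F}
    (hw : IsWeyl w) {π : Equiv.Perm (Fin n)} {e : Fin n → Prop}
    (hact : ∀ t y, w⁻¹ * torus t y * w = torus (weylAct π e t y) y) (t : Fin n → Fˣ) (s : Fˣ)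
    (ε : ℤˣ) : twist ⟨w, 1⟩ φ.toFun (plusElt t s ε) =
      φ.toFun (plusElt (weylAct π e t (s ^ 2)) s ε) := by
  have h : conj ⟨w, 1⟩ (plusElt t s ε : Mp n F) = plusElt (weylAct π e t (s ^ 2)) s ε :=
    conj_weyl hn hw hact t s ε
  rw [twist, dif_pos (by rw [h]; exact Subtype.coe_prop _)]
  congr 1
  exact Subtype.ext h

theorem exists_prod_weylAct_eq_sq (π : Equiv.Perm (Fin n)) (e : Fin n → Prop) {t : Fin n → Fˣ}
    (s : Fˣ) (ht : ∃ r, ∏ i, t i = r ^ 2) : ∃ r, ∏ i, weylAct π e t (s ^ 2) i = r ^ 2 := by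
  obtain ⟨r, hr⟩ := ht
  obtain ⟨v, hv⟩ := exists_prod_weylAct π e t s
  exact ⟨r * v, by rw [hv, hr, mul_pow]⟩

theorem twist_weyl_centralElt (hn : 1 ≤ n) (ω : GenuineChar (ZT n F)) {w : GSp n F}
    (hw : IsWeyl w) {π : Equiv.Perm (Fin n)} {e : Fin n → Prop}
    (hact : ∀ t y, w⁻¹ * torus t y * w = torus (weylAct π e t y) y) (t : Fin n → Fˣ) (s : Fˣ)
    (ε : ℤˣ) (ht : ∃ r, ∏ i, t i = r ^ 2) : twist ⟨w, 1⟩ ω.toFun (centralElt hn t s ε ht) =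
      ω.toFun (centralElt hn (weylAct π e t (s ^ 2)) s ε (exists_prod_weylAct_eq_sq π e s ht)) := by
  have h : conj ⟨w, 1⟩ (centralElt hn t s ε ht : Mp n F) =
      centralElt hn (weylAct π e t (s ^ 2)) s ε (exists_prod_weylAct_eq_sq π e s ht) :=
    conj_weyl hn hw hact t s ε
  rw [twist, dif_pos (by rw [h]; exact Subtype.coe_prop _)]
  congr 1
  exact Subtype.ext h

/-- Every pair `(π, e)` comes from a Weyl element, and the symbol depends only on the class of `c`.
Hence `R` can be studied in coordinates, with no matrices left. -/
theorem mk_mem_R_iff (hn : 1 ≤ n) (φ : GenuineChar (TPlus n F)) (c : Fˣ) :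
    (QuotientGroup.mk c : Fˣ ⧸ squares F) ∈ R φ.toFun ↔
      ∃ (π : Equiv.Perm (Fin n)) (e : Fin n → Prop), ∀ t s ε,
        φ.toFun (plusElt (weylAct π e t (s ^ 2)) s ε) =
          signUnit (hilbert (∏ i, t i) c) * φ.toFun (plusElt t s ε) := by
  constructor
  · rintro ⟨c', hc', w, hw, h⟩
    obtain ⟨π, e, hact⟩ := hw.exists_weylAct
    refine ⟨π, e, fun t s ε => ?_⟩
    obtain ⟨r, hr⟩ := mem_squares_iff.1 (QuotientGroup.eq.1 hc')
    obtain rfl : c = c' * r ^ 2 := by rw [← hr, mul_inv_cancel_left]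
    rw [← twist_weyl_plusElt hn φ hw hact, ← h, twist_iSim_plusElt hn, hilbert_mul_sq_right]
  · rintro ⟨π, e, h⟩
    obtain ⟨w, hw, hact⟩ := exists_isWeyl_weylAct F π e
    refine ⟨c, rfl, w, hw, funext fun x => ?_⟩
    obtain ⟨t, s, ε, rfl⟩ := exists_eq_plusElt x
    rw [twist_weyl_plusElt hn φ hw hact, h, twist_iSim_plusElt hn]

theorem one_mem_R (hn : 1 ≤ n) (φ : GenuineChar (TPlus n F)) : 1 ∈ R φ.toFun := by
  rw [← QuotientGroup.mk_one, mk_mem_R_iff hn]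
  refine ⟨1, fun _ => False, fun t s ε => ?_⟩
  have h : weylAct 1 (fun _ => False) t (s ^ 2) = t := by
    ext i
    simp [weylAct]
  rw [hilbert_one_right, map_one, one_mul, h]

theorem prod_const_eq_mul_sq (hn : Odd n) (a : Fˣ) : ∃ r, ∏ _i : Fin n, a = a * r ^ 2 := by
  obtain ⟨k, rfl⟩ := hn
  exact ⟨a ^ k, by rw [Finset.prod_const, Finset.card_univ, Fintype.card_fin, pow_succ, mul_comm, mul_comm 2, pow_mul]⟩

theorem twist_eq_of_odd (hn : Odd n) {ω : GenuineChar (ZT n F)} {w : GSp n F} (hw : IsWeyl w)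
    (h : twist ⟨w, 1⟩ ω.toFun = ω.toFun) {φ : GenuineChar (TPlus n F)} (hφ : φ ∈ E ω) :
    twist ⟨w, 1⟩ φ.toFun = φ.toFun := by
  have hn1 : 1 ≤ n := hn.pos
  obtain ⟨π, e, hact⟩ := hw.exists_weylAct
  ext1 x
  obtain ⟨t, s, ε, rfl⟩ := exists_eq_plusElt x
  rw [twist_weyl_plusElt hn1 φ hw hact]
  set a := ∏ i, t i with ha
  obtain ⟨r, hr⟩ := prod_const_eq_mul_sq hn a
  -- With `a = det t` and `n` odd, `det u = a^{1-n}` is a square, so `u` gives a central element and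
  -- only a scalar remains.
  set u : Fin n → Fˣ := t * fun _ => a⁻¹ with hu
  have hdet : ∃ v, ∏ i, u i = v ^ 2 := by
    refine ⟨r⁻¹, ?_⟩
    simp only [hu, Pi.mul_apply, Finset.prod_mul_distrib, Finset.prod_inv_distrib]
    rw [← ha, hr, mul_inv, mul_inv_cancel_left, inv_pow]
  have ht : t = u * fun _ => a := by
    ext i
    simp [hu]
  -- The scalar `a I` has similitude factor `a²`, which is split off from `s²`.
  obtain ⟨s, rfl⟩ : ∃ s', s = s' * a := ⟨s * a⁻¹, by simp⟩
  have hε : ε = ε * 1 := (mul_one ε).symm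
  have h1 : weylAct π e t ((s * a) ^ 2) = weylAct π e u (s ^ 2) * fun _ => a := by
    conv_lhs => rw [ht, mul_pow, weylAct_mul, weylAct_const]
  rw [h1]
  conv_lhs => rw [hε, GenuineChar.map_central_mul hn1 hφ _ _ _ _
    (exists_prod_weylAct_eq_sq π e _ hdet), ← twist_weyl_centralElt hn1 ω hw hact _ _ _ hdet, h]
  conv_rhs => rw [ht, hε, GenuineChar.map_central_mul hn1 hφ _ _ _ _ hdet]

theorem R_eq_of_odd [IsUltrametricDist F] [ProperSpace F] [CharZero F] (hn : Odd n)
    (φ : GenuineChar (TPlus n F)) : R φ.toFun = {1} := by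
  have hn1 : 1 ≤ n := hn.pos
  refine Set.eq_singleton_iff_unique_mem.2 ⟨one_mem_R hn1 φ, fun x hx => ?_⟩
  obtain ⟨c, rfl⟩ := QuotientGroup.mk_surjective x
  obtain ⟨π, e, h⟩ := (mk_mem_R_iff hn1 φ c).1 hx
  refine (QuotientGroup.eq_one_iff c).2 (mem_squares_of_hilbert_eq_one fun a => ?_)
  -- At a scalar the Weyl action is trivial, and the remaining sign is `(aⁿ, c) = (a, c)`.
  have h1 := h (fun _ => a) a 1
  obtain ⟨r, hr⟩ := prod_const_eq_mul_sq hn a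
  rw [weylAct_const, hr, hilbert_mul_sq_left, right_eq_mul] at h1
  exact signUnit_eq_one_iff.1 h1

/-- For a Weyl group element `w`, the ratio of `^w φ` and `φ` only depends on `ω`. -/
theorem map_weylAct_mul_comm (hn : 1 ≤ n) {ω : GenuineChar (ZT n F)}
    {φ φ' : GenuineChar (TPlus n F)} (hφ : φ ∈ E ω) (hφ' : φ' ∈ E ω) (π : Equiv.Perm (Fin n))
    (e : Fin n → Prop) (t : Fin n → Fˣ) (s : Fˣ) (ε : ℤˣ) : ∃ z : ℂˣ,
    φ.toFun (plusElt (weylAct π e t (s ^ 2)) s ε) = z * φ.toFun (plusElt t s ε) ∧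
    φ'.toFun (plusElt (weylAct π e t (s ^ 2)) s ε) = z * φ'.toFun (plusElt t s ε) := by
  obtain ⟨r, hr⟩ := exists_prod_weylAct π e t s
  have hdet : ∃ v, ∏ i, (weylAct π e t (s ^ 2) * t⁻¹) i = v ^ 2 := by
    refine ⟨r, ?_⟩
    simp only [Pi.mul_apply, Finset.prod_mul_distrib, Pi.inv_apply, Finset.prod_inv_distrib]
    rw [hr, mul_right_comm, mul_inv_cancel, one_mul]
  have h1 : weylAct π e t (s ^ 2) * t⁻¹ * t = weylAct π e t (s ^ 2) := inv_mul_cancel_right _ _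
  -- The ratio is the value of `ω` at `[t^w t⁻¹, 1]`, which is central because its determinant is a
  -- square.
  refine ⟨ω.toFun (centralElt hn _ 1 1 hdet), ?_, ?_⟩
  · rw [← GenuineChar.map_central_mul hn hφ, h1, one_mul, one_mul]
  · rw [← GenuineChar.map_central_mul hn hφ', h1, one_mul, one_mul]

theorem R_eq_of_mem_E (hn : 1 ≤ n) {ω : GenuineChar (ZT n F)} {φ φ' : GenuineChar (TPlus n F)}
    (hφ : φ ∈ E ω) (hφ' : φ' ∈ E ω) : R φ.toFun = R φ'.toFun := by
  ext x
  obtain ⟨c, rfl⟩ := QuotientGroup.mk_surjective x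
  rw [mk_mem_R_iff hn, mk_mem_R_iff hn]
  refine exists_congr fun π => exists_congr fun e => forall_congr' fun t => forall_congr' fun s =>
    forall_congr' fun ε => ?_
  obtain ⟨z, h1, h2⟩ := map_weylAct_mul_comm hn hφ hφ' π e t s ε
  rw [h1, h2, mul_left_inj, mul_left_inj]

end Characters

/-! ### Unramified parameters for even `n` -/

section Unramified

variable {n : ℕ} {F : Type*} [NontriviallyNormedField F]

theorem weylConj_iff {ϖ : Fˣ} (hϖ : IsUniformizer ϖ) (hn : 1 ≤ n) {α β : Fin n → ℂˣ} :
    WeylConj ϖ α β ↔ ∃ (π : Equiv.Perm (Fin n)) (e : Fin n → Prop), weylParam π e α = β := by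
  constructor
  · rintro ⟨w, hw, h⟩
    obtain ⟨π, e, hact⟩ := hw.exists_weylAct
    refine ⟨π, e, chiAlpha_injective hϖ fun t => ?_⟩
    rw [← chiAlpha_weylAct hϖ]
    exact (h t _ (hact t 1).symm).symm
  · rintro ⟨π, e, rfl⟩
    obtain ⟨w, hw, hact⟩ := exists_isWeyl_weylAct F π e
    refine ⟨w, hw, fun t t' ht => ?_⟩
    rw [hact] at ht
    rw [((torus_inj hn).1 ht).1, chiAlpha_weylAct hϖ]

variable [IsUltrametricDist F] [ProperSpace F] [CharZero F]

/-- For even `n` the scalar part has square determinant and is fixed by the Weyl group, so it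
contributes equally to both sides. The Weil factors cancel too, since they see only the square class
of `det t`. -/
theorem IsStandard.map_weylAct_iff {ϖ : Fˣ} {ψ : AddChar F Circle} (hψ : IsNormalized ϖ ψ)
    (hn1 : 1 ≤ n) (hn : Even n) {α : Fin n → ℂˣ} {β : ℂˣ} {φ : GenuineChar (TPlus n F)}
    (hφ : IsStandard ϖ ψ α β φ) (c : Fˣ) (π : Equiv.Perm (Fin n)) (e : Fin n → Prop) :
    (∀ t s ε, φ.toFun (plusElt (weylAct π e t (s ^ 2)) s ε) =
      signUnit (hilbert (∏ i, t i) c) * φ.toFun (plusElt t s ε)) ↔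
    ∀ t, chiAlpha ϖ α (weylAct π e t 1) =
      signUnit (hilbert (∏ i, t i) c) * chiAlpha ϖ α t := by
  obtain ⟨k, hk⟩ := hn
  have hconst : ∀ s : Fˣ, ∏ _i : Fin n, s = (s ^ k) ^ 2 := fun s => by
    rw [Finset.prod_const, Finset.card_univ, Fintype.card_fin, hk, ← two_mul, mul_comm, pow_mul]
  have hval : ∀ (s : Fˣ) (t : Fin n → Fˣ) (ε : ℤˣ),
      (φ.toFun (plusElt ((fun _ => s) * t) s ε) : ℂ) =
        (((ε : ℤ) : ℂ) * ((β ^ ord ϖ s : ℂˣ) : ℂ) * weilFactor ψ (s ^ n)) *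
          (chiAlpha ϖ α t * weilFactor ψ (∏ i, t i)) := fun s t ε => by
    rw [hφ s t ε 1]
    · simp [mul_assoc]
    · rw [Mp.torus_mul hn1, hconst, hilbert_sq_left, hilbert_sq_left]
      simp [plusElt]
  -- Nonvanishing of the Weil factors is read off from the fact that `φ` takes values in `ℂˣ`.
  have hne : ∀ (s : Fˣ) (t : Fin n → Fˣ) (ε : ℤˣ),
      (((ε : ℤ) : ℂ) * ((β ^ ord ϖ s : ℂˣ) : ℂ) * weilFactor ψ (s ^ n)) ≠ 0 ∧
        weilFactor ψ (∏ i, t i) ≠ 0 := fun s t ε => by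
    have h0 := (φ.toFun (plusElt ((fun _ => s) * t) s ε)).ne_zero
    rw [hval] at h0
    exact ⟨left_ne_zero_of_mul h0, right_ne_zero_of_mul (right_ne_zero_of_mul h0)⟩
  have key : ∀ (s : Fˣ) (t : Fin n → Fˣ) (ε : ℤˣ),
      φ.toFun (plusElt (weylAct π e ((fun _ => s) * t) (s ^ 2)) s ε) =
        signUnit (hilbert (∏ i, ((fun _ => s) * t : Fin n → Fˣ) i) c) *
          φ.toFun (plusElt ((fun _ => s) * t) s ε) ↔
      chiAlpha ϖ α (weylAct π e t 1) = signUnit (hilbert (∏ i, t i) c) * chiAlpha ϖ α t := by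
    intro s t ε
    obtain ⟨r, hr⟩ := exists_prod_weylAct π e t 1
    have h1 : weylAct π e ((fun _ => s) * t) (s ^ 2) = (fun _ => s) * weylAct π e t 1 := by
      conv_lhs => rw [← mul_one (s ^ 2), weylAct_mul, weylAct_const]
    have h2 : ∏ i, ((fun _ => s) * t : Fin n → Fˣ) i = (∏ i, t i) * (s ^ k) ^ 2 := by
      simp only [Pi.mul_apply, Finset.prod_mul_distrib]
      rw [hconst, mul_comm]
    rw [one_pow] at hr
    rw [h1, h2, hilbert_mul_sq_left, Units.ext_iff, Units.ext_iff, Units.val_mul, Units.val_mul,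
      hval, hval, hr, weilFactor_mul_sq hψ]
    obtain ⟨hA, hW⟩ := hne s t ε
    constructor
    · intro h
      refine mul_right_cancel₀ (mul_ne_zero hA hW) ?_
      linear_combination h
    · intro h
      rw [h]
      ring
  constructor
  · intro h t
    exact (key 1 t 1).1 (h _ 1 1)
  · intro h t s ε
    have ht : t = (fun _ => s) * ((fun _ => s⁻¹) * t) := by
      ext i
      simp
    rw [ht]
    exact (key s _ ε).2 (h _)

/-- Up to squares `c` is a nonsquare unit, so `(·, c)` is the quadratic character of the unramified
extension. -/
theorem hilbert_eq_neg_one_zpow_ord (h2 : ‖(2 : F)‖ = 1) {ϖ : Fˣ} (hϖ : IsUniformizer ϖ) {c : Fˣ}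
    (hc : ¬ IsSquare (c : F)) (hord : Even (ord ϖ c)) (a : Fˣ) :
    hilbert a c = (-1) ^ ord ϖ a := by
  obtain ⟨k, hk⟩ := hord
  set v := c * (ϖ ^ (-k)) ^ 2 with hv
  have hva : hilbert a c = hilbert a v := (hilbert_mul_sq_right a c _).symm
  have hv1 : ‖(v : F)‖ = 1 := by
    rw [hv, Units.val_mul, norm_mul, hϖ.norm_eq c, hk, Units.val_pow_eq_pow_val, norm_pow,
      Units.val_zpow_eq_zpow_val, norm_zpow, ← zpow_natCast, ← zpow_mul, ← zpow_add₀ hϖ.norm_pos.ne']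
    rw [show k + k + -k * ((2 : ℕ) : ℤ) = 0 by push_cast; ring, zpow_zero]
  have hvs : ¬ IsSquare (v : F) := by
    rw [isSquare_coe_iff] at hc ⊢
    rintro ⟨r, hr⟩
    refine hc ⟨r / ϖ ^ (-k), ?_⟩
    rw [div_pow, ← hr, hv, mul_div_cancel_right]
  rw [hva]
  rcases Int.even_or_odd (ord ϖ a) with he | ho
  · rw [he.neg_one_zpow]
    obtain ⟨j, hj⟩ := he
    rw [← hilbert_mul_sq_left a v (ϖ ^ (-j))]
    refine hilbert_eq_one_of_norm_eq_one h2 ?_ hv1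
    rw [Units.val_mul, norm_mul, hϖ.norm_eq a, hj, Units.val_pow_eq_pow_val, norm_pow,
      Units.val_zpow_eq_zpow_val, norm_zpow, ← zpow_natCast, ← zpow_mul, ← zpow_add₀ hϖ.norm_pos.ne']
    rw [show j + j + -j * ((2 : ℕ) : ℤ) = 0 by push_cast; ring, zpow_zero]
  · rw [ho.neg_one_zpow, hilbert_comm]
    refine (Int.units_eq_one_or _).resolve_left (hilbert_ne_one_of_odd h2 hv1 hvs ?_)
    rw [hϖ.exists_norm_eq_sq_iff, Int.not_even_iff_odd]
    exact ho

theorem even_ord_of_hilbert_eq_one (h2 : ‖(2 : F)‖ = 1) {ϖ : Fˣ} (hϖ : IsUniformizer ϖ) {c : Fˣ}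
    (h : ∀ a : Fˣ, ‖(a : F)‖ = 1 → hilbert a c = 1) : Even (ord ϖ c) := by
  obtain ⟨v, hv, hvs⟩ := exists_norm_eq_one_not_isSquare F
  rw [← hϖ.exists_norm_eq_sq_iff]
  by_contra hodd
  exact hilbert_ne_one_of_odd h2 hv hvs hodd (h v hv)

/-- In odd residual characteristic a unit is a square exactly when its residue is, and the quadratic
character of the residue field is multiplicative. -/
theorem isSquare_mul_of_not_isSquare (h2 : ‖(2 : F)‖ = 1) {a b : Fˣ} (ha : ‖(a : F)‖ = 1)
    (hb : ‖(b : F)‖ = 1) (has : ¬ IsSquare (a : F)) (hbs : ¬ IsSquare (b : F)) :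
    IsSquare ((a : F) * b) := by
  obtain ⟨k, _, _, O, r, hr, hO, hr0⟩ := exists_finite_residue_ring F
  have : Fintype k := Fintype.ofFinite k
  have key : ∀ x : O, ‖(x : F)‖ = 1 → (IsSquare (x : F) ↔ IsSquare (r x)) := fun x hx => by
    constructor
    · rintro ⟨y, hy⟩
      have hy1 : ‖y‖ ≤ 1 := by
        rw [hy, norm_mul, ← sq] at hx
        exact ((pow_eq_one_iff_of_nonneg (norm_nonneg _) two_ne_zero).1 hx).le
      refine ⟨r ⟨y, (hO y).2 hy1⟩, ?_⟩
      rw [← map_mul]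
      exact congrArg r (Subtype.ext hy)
    · rintro ⟨y, hy⟩
      obtain ⟨y, rfl⟩ := hr y
      refine isSquare_of_norm_sub_sq_lt h2 (r := y) hx ((hr0 (x - y ^ 2)).1 ?_)
      rw [map_sub, map_pow, hy, sq, sub_self]
  set a' : O := ⟨a, (hO _).2 ha.le⟩
  set b' : O := ⟨b, (hO _).2 hb.le⟩
  have hsa : ¬ IsSquare (r a') := fun h => has ((key a' ha).2 h)
  have hsb : ¬ IsSquare (r b') := fun h => hbs ((key b' hb).2 h)
  have hab : r (a' * b') ≠ 0 := fun h => by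
    have : ‖(a : F) * b‖ < 1 := (hr0 _).1 h
    simp [ha, hb] at this
  refine (key (a' * b') (by simp [a', b', ha, hb])).2 ?_
  rw [← quadraticChar_one_iff_isSquare hab, map_mul, map_mul,
    quadraticChar_neg_one_iff_not_isSquare.2 hsa, quadraticChar_neg_one_iff_not_isSquare.2 hsb]
  norm_num

theorem IsStandard.mk_mem_R_iff (h2 : ‖(2 : F)‖ = 1) {ϖ : Fˣ} (hϖ : IsUniformizer ϖ)
    {ψ : AddChar F Circle} (hψ : IsNormalized ϖ ψ) (hn1 : 1 ≤ n) (hn : Even n) {α : Fin n → ℂˣ}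
    {β : ℂˣ} {φ : GenuineChar (TPlus n F)} (hφ : IsStandard ϖ ψ α β φ) {c : Fˣ}
    (hc : ¬ IsSquare (c : F)) : (QuotientGroup.mk c : Fˣ ⧸ squares F) ∈ R φ.toFun ↔
      Even (ord ϖ c) ∧ WeylConj (F := F) ϖ α (-α) := by
  rw [Metaplectic.mk_mem_R_iff hn1, weylConj_iff hϖ hn1]
  simp only [hφ.map_weylAct_iff hψ hn1 hn, chiAlpha_weylAct hϖ]
  have hneg : Even (ord ϖ c) → ∀ t, signUnit (hilbert (∏ i, t i) c) * chiAlpha ϖ α t =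
      chiAlpha ϖ (-α) t := fun he t => by
    rw [chiAlpha_neg hϖ, hilbert_eq_neg_one_zpow_ord h2 hϖ hc he, map_zpow, signUnit_neg_one]
  constructor
  · rintro ⟨π, e, h⟩
    have he : Even (ord ϖ c) := by
      refine even_ord_of_hilbert_eq_one h2 hϖ fun a ha => ?_
      -- A unit placed in a single coordinate: `χ_α` is trivial on both sides, so only `(a, c) = 1`
      -- remains.
      have h1 := h (Pi.mulSingle ⟨0, hn1⟩ a)
      have h3 : ∀ i, ord ϖ ((Pi.mulSingle ⟨0, hn1⟩ a : Fin n → Fˣ) i) = 0 := fun i => by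
        refine hϖ.ord_of_norm_eq_one ?_
        by_cases hi : i = ⟨0, hn1⟩
        · rw [hi, Pi.mulSingle_eq_same, ha]
        · rw [Pi.mulSingle_eq_of_ne hi, Units.val_one, norm_one]
      simp only [chiAlpha, h3, zpow_zero, Finset.prod_const_one, mul_one] at h1
      rw [Finset.univ.prod_pi_mulSingle'] at h1
      simpa [signUnit_eq_one_iff] using h1.symm
    refine ⟨he, π, e, chiAlpha_injective hϖ fun t => ?_⟩
    rw [h, hneg he]
  · rintro ⟨he, π, e, h⟩
    exact ⟨π, e, fun t => by rw [hneg he, h]⟩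

end Unramified

/-! ### The size of `R` -/

section Unramified

theorem weylConj_neg_iff {n : ℕ} {F : Type*} [NontriviallyNormedField F] {ϖ : Fˣ} (hϖ : IsUniformizer ϖ)
    (hn1 : 1 ≤ n) (hn : Even n)
    (α : Fin n → ℂˣ) : WeylConj (F := F) ϖ α (-α) ↔
      ∃ a : ℕ → ℂˣ, WeylConj (F := F) ϖ α (pairedAlpha n a) := by
  simp only [weylConj_iff hϖ hn1, exists_weylParam_iff]
  exact exists_perm_neg_iff_exists_paired hn α

variable {n : ℕ} {F : Type*} [NontriviallyNormedField F] [IsUltrametricDist F] [ProperSpace F]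
  [CharZero F]

/-- Only one nontrivial square class has even order, that of the nonsquare units; this bounds `R` by
two elements. -/
theorem exists_R_subset_pair (h2 : ‖(2 : F)‖ = 1) {ϖ : Fˣ} (hϖ : IsUniformizer ϖ) :
    ∃ c : Fˣ, ¬ IsSquare (c : F) ∧ Even (ord ϖ c) ∧ ∀ b : Fˣ, ¬ IsSquare (b : F) →
      Even (ord ϖ b) → (QuotientGroup.mk b : Fˣ ⧸ squares F) = QuotientGroup.mk c := by
  obtain ⟨c, hc, hcs⟩ := exists_norm_eq_one_not_isSquare F
  refine ⟨c, hcs, by rw [hϖ.ord_of_norm_eq_one hc]; exact Even.zero, fun b hb he => ?_⟩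
  obtain ⟨k, hk⟩ := he
  have hbn : ‖((b * (ϖ ^ (-k)) ^ 2 : Fˣ) : F)‖ = 1 := by
    rw [hϖ.norm_eq, hϖ.ord_mul, sq, hϖ.ord_mul, hk, hϖ.ord_eq (k := -k) (by simp)]
    rw [show k + k + (-k + -k) = 0 by ring, zpow_zero]
  have hbs : ¬ IsSquare ((b * (ϖ ^ (-k)) ^ 2 : Fˣ) : F) := by
    rw [isSquare_coe_iff] at hb ⊢
    rintro ⟨r, hr⟩
    exact hb ⟨r / ϖ ^ (-k), by rw [div_pow, ← hr, mul_div_cancel_right]⟩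
  have h := isSquare_mul_of_not_isSquare h2 hbn hc hbs hcs
  rw [← Units.val_mul, isSquare_coe_iff] at h
  obtain ⟨r, hr⟩ := h
  rw [QuotientGroup.eq, mem_squares_iff]
  refine ⟨r / (b * ϖ ^ (-k)), ?_⟩
  rw [div_pow, ← hr]
  generalize ϖ ^ (-k) = p
  refine Units.ext ?_
  push_cast
  field_simp

theorem IsStandard.encard_R (h2 : ‖(2 : F)‖ = 1) {ϖ : Fˣ} (hϖ : IsUniformizer ϖ)
    {ψ : AddChar F Circle} (hψ : IsNormalized ϖ ψ) (hn1 : 1 ≤ n) (hn : Even n) {α : Fin n → ℂˣ}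
    {β : ℂˣ} {φ : GenuineChar (TPlus n F)} (hφ : IsStandard ϖ ψ α β φ) :
    (1 < (R φ.toFun).encard ↔ WeylConj (F := F) ϖ α (-α)) ∧
      (1 < (R φ.toFun).encard → (R φ.toFun).encard = 2) := by
  obtain ⟨c, hcs, hce, hc⟩ := exists_R_subset_pair h2 hϖ
  have hsq : ∀ b : Fˣ, (QuotientGroup.mk b : Fˣ ⧸ squares F) ≠ 1 → ¬ IsSquare (b : F) :=
    fun b hb hbs => hb ((QuotientGroup.eq_one_iff b).2
      (mem_squares_iff.2 (isSquare_coe_iff.1 hbs)))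
  have hc1 : (QuotientGroup.mk c : Fˣ ⧸ squares F) ≠ 1 := fun h =>
    hcs (isSquare_coe_iff.2 (mem_squares_iff.1 ((QuotientGroup.eq_one_iff c).1 h)))
  by_cases hW : WeylConj (F := F) ϖ α (-α)
  · have hR : R φ.toFun = {1, QuotientGroup.mk c} := by
      refine Set.Subset.antisymm (fun x hx => ?_) ?_
      · obtain ⟨b, rfl⟩ := QuotientGroup.mk_surjective x
        by_cases hb : (QuotientGroup.mk b : Fˣ ⧸ squares F) = 1
        · exact Or.inl hb
        · exact Or.inr (hc b (hsq b hb)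
            ((hφ.mk_mem_R_iff h2 hϖ hψ hn1 hn (hsq b hb)).1 hx).1)
      · rintro x (rfl | rfl)
        · exact one_mem_R hn1 φ
        · exact (hφ.mk_mem_R_iff h2 hϖ hψ hn1 hn hcs).2 ⟨hce, hW⟩
    have h3 : (R φ.toFun).encard = 2 := by rw [hR, Set.encard_pair hc1.symm]
    refine ⟨iff_of_true ?_ hW, fun _ => h3⟩
    rw [h3]
    norm_num
  · have hR : R φ.toFun = {1} := by
      refine Set.eq_singleton_iff_unique_mem.2 ⟨one_mem_R hn1 φ, fun x hx => ?_⟩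
      obtain ⟨b, rfl⟩ := QuotientGroup.mk_surjective x
      by_contra hb
      exact hW ((hφ.mk_mem_R_iff h2 hϖ hψ hn1 hn (hsq b hb)).1 hx).2
    have h3 : ¬ 1 < (R φ.toFun).encard := by rw [hR, Set.encard_singleton]; exact lt_irrefl _
    exact ⟨iff_of_false h3 hW, fun h => absurd h h3⟩

end Unramified

end Metaplectic

end

/-! ### The main theorem -/

theorem lemma7p1 {F : Type*} [NontriviallyNormedField F] [IsUltrametricDist F] [ProperSpace F]
    [CharZero F] (n : ℕ) (hn : 1 ≤ n) :
    (Odd n → ∀ ω : Metaplectic.GenuineChar (Metaplectic.ZT n F),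
      (∀ w : Metaplectic.GSp n F, Metaplectic.IsWeyl w →
        Metaplectic.twist ⟨w, 1⟩ ω.toFun = ω.toFun →
          ∀ φ ∈ Metaplectic.E ω, Metaplectic.twist ⟨w, 1⟩ φ.toFun = φ.toFun) ∧
      ∀ φ ∈ Metaplectic.E ω, Metaplectic.R φ.toFun = {1}) ∧
    (‖(2 : F)‖ = 1 → ∀ (ϖ : Fˣ), Metaplectic.IsUniformizer ϖ →
      ∀ ψ : AddChar F Circle, Metaplectic.IsNormalized ϖ ψ →
      ∀ ω : Metaplectic.GenuineChar (Metaplectic.ZT n F), Metaplectic.IsUnramified ω →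
      ∀ (α : Fin n → ℂˣ) (β : ℂˣ), (∃ φ₀ ∈ Metaplectic.E ω, Metaplectic.IsStandard ϖ ψ α β φ₀) →
      ∀ φ ∈ Metaplectic.E ω,
        (1 < (Metaplectic.R φ.toFun).encard ↔
          Even n ∧ ∃ a : ℕ → ℂˣ, Metaplectic.WeylConj (F := F) ϖ α (Metaplectic.pairedAlpha n a)) ∧
        (1 < (Metaplectic.R φ.toFun).encard → (Metaplectic.R φ.toFun).encard = 2)) := by
  refine ⟨fun hodd ω => ⟨fun w hw h φ hφ => Metaplectic.twist_eq_of_odd hodd hw h hφ,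
    fun φ _ => Metaplectic.R_eq_of_odd hodd φ⟩, ?_⟩
  rintro h2 ϖ hϖ ψ hψ ω - α β ⟨φ₀, hφ₀, hstd⟩ φ hφ
  rcases Nat.even_or_odd n with he | ho
  · rw [Metaplectic.R_eq_of_mem_E hn hφ hφ₀, ← Metaplectic.weylConj_neg_iff hϖ hn he]
    obtain ⟨h3, h4⟩ := hstd.encard_R h2 hϖ hψ hn he
    exact ⟨by rw [h3, and_iff_right he], h4⟩
  · have h3 : ¬ 1 < (Metaplectic.R φ.toFun).encard := by
      rw [Metaplectic.R_eq_of_odd ho, Set.encard_singleton]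
      exact lt_irrefl _
    exact ⟨iff_of_false h3 fun h => Nat.not_even_iff_odd.2 ho h.1, fun h => absurd h h3⟩
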